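/- Let $n\in\{2,3\}$, $c>0$, $T>0$, let $\Omega\subset\mathbb R^n$ be a bounded open set with Lipschitz boundary, let $\Gamma\subset\partial\Omega$ be a Borel set, equipped with the surface measure, and let $\lambda\in L^\infty(\Omega\times(0,T])$. All function spaces are real. For $f\in L^2(\Omega)$, extended by zero outside $\Omega$, consider the direct problem $$\frac1{c^2}\partial_t^2U-\Delta U=\lambda(x,t)f(x)\ \text{ in }\mathbb R^n\times(0,T],\qquad U(\cdot,0)=\partial_tU(\cdot,0)=0 .$$ A weak solution is a function $U\in L^2(0,T;H^1(\mathbb R^n))$ such that $\int_0^T\!\int_{\mathbb R^n}U\,(c^{-2}\partial_t^2\varphi-\Delta\varphi)\,dx\,dt=\int_0^T\!\int_\Omega\lambda f\varphi\,dx\,dt$ for all $\varphi\in C_c^\infty(\mathbb R^n\times(-\infty,T))$. For $V\in L^2(\Gamma\times(0,T])$, regarded as a source concentrated on $\Gamma$, consider the time-reversed problem $$\frac1{c^2}\partial_t^2W-\Delta W=V\ \text{ in }\mathbb R^n\times(0,T],\qquad W(\cdot,T)=\partial_tW(\cdot,T)=0 .$$ A weak solution is a function $W\in L^2(\mathbb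 R^n\times(0,T])$ such that $\int_0^T\!\int_{\mathbb R^n}W\,(c^{-2}\partial_t^2\varphi-\Delta\varphi)\,dx\,dt=\int_0^T\!\int_\Gamma V\varphi\,dS\,dt$ for all $\varphi\in C_c^\infty(\mathbb R^n\times(0,\infty))$. Then both problems have exactly one weak solution for every $f\in L^2(\Omega)$ and every $V\in L^2(\Gamma\times(0,T])$, respectively, and the forward operator $\mathcal F:f\mapsto U|_{\Gamma\times(0,T]}$ (trace of the weak solution $U$ of the direct problem) is a well-defined bounded linear operator $L^2(\Omega)\to L^2(\Gamma\times(0,T])$. Moreover: 1. For every $U_{\mathrm{data}}\in L^2(\Gamma\times(0,T])$, the functional $\mathcal J(f)=\frac12\|\mathcal F f-U_{\mathrm{data}}\|^2_{L^2(\Gamma\times(0,T])}$ is Fréchet differentiable on $L^2(\Omega)$, and its derivative, identified with an element of $L^2(\Omega)$ through the inner product, is $$D\mathcal J(f)=\mathcal F^*(\mathcal F f-U_{\mathrm{data}})\qquad\text{for all } f\in L^2(\Omega).$$ 2. The adjoint $\mathcal F^*:L^2(\Gamma\times(0,T])\to L^2(\Omega)$ is given by $\mathcal F^*V=g$ with $$g(x)=\int_0^T\lambda(x,t)\,W(x,t)\,dt\qquad\text{for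 a.e. }x\in\Omega,$$ where $W$ is the weak solution of the time-reversed problem with source $V$; for a.e. $x\in\Omega$ the integrand is integrable on $(0,T]$. -/

import Mathlib

open MeasureTheory Set Filter Topology
open scoped ENNReal NNReal ContDiff InnerProductSpace

noncomputable section

namespace InverseSource

/-- Euclidean space of dimension `n`. Points of space-time are pairs `(x, t) : Space n × ℝ`. -/
abbrev Space (n : ℕ) : Type := EuclideanSpace ℝ (Fin n)

/-- Near each of its boundary points, `Ω` is the region lying strictly on one side of the graph
of a Lipschitz function over the hyperplane orthogonal to some unit vector `e`. -/
def HasLipschitzBoundary {n : ℕ} (Ω : Set (Space n)) : Prop :=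
  ∀ p ∈ frontier Ω, ∃ (e : Space n) (γ : (ℝ ∙ e)ᗮ → ℝ) (K : ℝ≥0) (r : ℝ),
    ‖e‖ = 1 ∧ LipschitzWith K γ ∧ 0 < r ∧
      ∀ x ∈ Metric.ball p r,
        (x ∈ Ω ↔ γ ((ℝ ∙ e)ᗮ.orthogonalProjectionOnto x) < inner ℝ e x)

/-- Lebesgue measure on `ℝⁿ × (0,T]`. -/
def slab (n : ℕ) (T : ℝ) : Measure (Space n × ℝ) :=
  (volume : Measure (Space n × ℝ)).restrict (univ ×ˢ Ioc 0 T)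

/-- Lebesgue measure on the cylinder `Ω × (0,T]`. -/
def cylinder {n : ℕ} (Ω : Set (Space n)) (T : ℝ) : Measure (Space n × ℝ) :=
  (volume : Measure (Space n × ℝ)).restrict (Ω ×ˢ Ioc 0 T)

/-- Surface measure (the `(n-1)`-dimensional Hausdorff measure with the Euclidean normalization)
on `Γ`, times Lebesgue measure on `(0,T]`. -/
def lateral {n : ℕ} (Γ : Set (Space n)) (T : ℝ) : Measure (Space n × ℝ) :=
  ((μHE[n - 1] : Measure (Space n)).restrict Γ).prod
    ((volume : Measure ℝ).restrict (Ioc 0 T))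

/-- The real Hilbert space `L²(Ω)`. -/
abbrev L2Dom {n : ℕ} (Ω : Set (Space n)) : Type :=
  Lp ℝ 2 ((volume : Measure (Space n)).restrict Ω)

/-- The real Hilbert space `L²(Γ × (0,T])`. -/
abbrev L2Lat {n : ℕ} (Γ : Set (Space n)) (T : ℝ) : Type := Lp ℝ 2 (lateral Γ T)

/-- The real Hilbert space `L²(ℝⁿ × (0,T])`. -/
abbrev L2Slab (n : ℕ) (T : ℝ) : Type := Lp ℝ 2 (slab n T)

/-- `φ ∈ C_c^∞(ℝⁿ × ℝ)`. -/
def IsTest {n : ℕ} (φ : Space n × ℝ → ℝ) : Prop :=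
  ContDiff ℝ ∞ φ ∧ HasCompactSupport φ

/-- The wave operator `c⁻² ∂ₜ² - Δₓ` on (smooth) functions of space and time. -/
def waveOp {n : ℕ} (c : ℝ) (φ : Space n × ℝ → ℝ) (p : Space n × ℝ) : ℝ :=
  1 / c ^ 2 * iteratedDeriv 2 (fun t => φ (p.1, t)) p.2
    - Laplacian.laplacian (fun x => φ (x, p.2)) p.1

/-- The spatial gradient `∇ₓ φ` of a (smooth) function of space and time. -/
def gradX {n : ℕ} (φ : Space n × ℝ → ℝ) (p : Space n × ℝ) : Space n :=
  gradient (fun x => φ (x, p.2)) p.1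

/-- `G ∈ L²(ℝⁿ × (0,T); ℝⁿ)` is the weak spatial gradient of `U ∈ L²(ℝⁿ × (0,T))`. The existence
of such a `G` says that `U` belongs to `L²(0,T; H¹(ℝⁿ))`. -/
def IsWeakGradX {n : ℕ} (T : ℝ) (U : L2Slab n T) (G : Space n × ℝ → Space n) : Prop :=
  MemLp G 2 (slab n T) ∧
    ∀ φ : Space n × ℝ → ℝ, IsTest φ → tsupport φ ⊆ univ ×ˢ Ioo 0 T →
      ∫ p, U p • gradX φ p ∂(slab n T) = - ∫ p, φ p • G p ∂(slab n T)

/-- `U` is the weak solution, in the class `L²(0,T; H¹(ℝⁿ))`, of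
`c⁻² ∂ₜ² U - Δ U = λ f` in `ℝⁿ × (0,T]`, `U(·,0) = ∂ₜ U(·,0) = 0`,
where `f` is extended by zero outside `Ω`.
The test functions vanish near `t = T` but are unrestricted at `t = 0`: after integration by parts
in time this encodes both initial conditions. -/
def IsDirectSolution {n : ℕ} (c T : ℝ) (Ω : Set (Space n)) (lam : Space n × ℝ → ℝ)
    (f : L2Dom Ω) (U : L2Slab n T) : Prop :=
  (∃ G, IsWeakGradX T U G) ∧
    ∀ φ : Space n × ℝ → ℝ, IsTest φ → tsupport φ ⊆ univ ×ˢ Iio T →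
      ∫ p, U p * waveOp c φ p ∂(slab n T) = ∫ p, lam p * f p.1 * φ p ∂(cylinder Ω T)

/-- `W ∈ L²(ℝⁿ × (0,T])` is the weak solution of the time-reversed problem
`c⁻² ∂ₜ² W - Δ W = V` in `ℝⁿ × (0,T]`, `W(·,T) = ∂ₜ W(·,T) = 0`,
where `V ∈ L²(Γ × (0,T])` is the source concentrated on the surface `Γ`, that is, the distribution
`φ ↦ ∫₀ᵀ ∫_Γ V φ dS dt`. The test functions vanish near `t = 0` but are unrestricted at `t = T`:
after integration by parts in time this encodes both final conditions. -/
def IsAdjointSolution {n : ℕ} (c T : ℝ) (Γ : Set (Space n))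
    (V : L2Lat Γ T) (W : L2Slab n T) : Prop :=
  ∀ φ : Space n × ℝ → ℝ, IsTest φ → tsupport φ ⊆ univ ×ˢ Ioi 0 →
    ∫ p, W p * waveOp c φ p ∂(slab n T) = ∫ p, V p * φ p ∂(lateral Γ T)

/-- `v ∈ L²(Γ × (0,T])` is the trace `U|_{Γ × (0,T]}` of `U ∈ L²(0,T; H¹(ℝⁿ))`: the trace operator
is the closure of the restriction of smooth functions. -/
def IsTrace {n : ℕ} {Γ : Set (Space n)} {T : ℝ} (U : L2Slab n T) (v : L2Lat Γ T) : Prop :=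
  ∃ (G : Space n × ℝ → Space n) (φ : ℕ → Space n × ℝ → ℝ),
    IsWeakGradX T U G ∧ (∀ k, IsTest (φ k)) ∧
    Tendsto (fun k => eLpNorm (fun p => φ k p - U p) 2 (slab n T)) atTop (𝓝 0) ∧
    Tendsto (fun k => eLpNorm (fun p => gradX (φ k) p - G p) 2 (slab n T)) atTop (𝓝 0) ∧
    Tendsto (fun k => eLpNorm (fun p => φ k p - v p) 2 (lateral Γ T)) atTop (𝓝 0)

/-- `F` is the forward operator `f ↦ U|_{Γ × (0,T]}`, with `U` the solution of the direct
problem. -/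
def IsForwardOperator {n : ℕ} (c T : ℝ) (Ω Γ : Set (Space n)) (lam : Space n × ℝ → ℝ)
    (F : L2Dom Ω →L[ℝ] L2Lat Γ T) : Prop :=
  ∀ (f : L2Dom Ω) (v : L2Lat Γ T),
    F f = v ↔ ∃ U : L2Slab n T, IsDirectSolution c T Ω lam f U ∧ IsTrace U v

/-- The least-squares functional `J(f) = ½ ‖F f - U_data‖²` on `L²(Ω)`. -/
def leastSquares {n : ℕ} {T : ℝ} {Ω Γ : Set (Space n)} (F : L2Dom Ω →L[ℝ] L2Lat Γ T)
    (Udata : L2Lat Γ T) (f : L2Dom Ω) : ℝ :=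
  1 / 2 * ‖F f - Udata‖ ^ 2

end InverseSource

end

/-! Write □ for the wave operator. Everything is built from test functions `φ` supported in `t > 0`
but free at `t = T`: such a `φ` solves the direct problem with source `□φ`, so no solution has to be
constructed by hand.

Two facts make this work. The first is an a priori bound: the norms of `φ` and `∇ₓφ` on the slab are
controlled by `□φ` (`exists_wave_estimate`, from the weighted identity `energy_identity` with weight
`T - t`), and the norm on `Γ × (0,T]` is controlled by the two former ones through a trace
inequality for Lipschitz graphs (`exists_trace_inequality`). The second is density of the functions
`□φ` in `L²` of the slab (`denseRange_posWave`): a `W` orthogonal to all of them is a very weak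
solution of the homogeneous backward problem. Such a `W` vanishes, because after time reversal,
extension by zero and mollification it becomes a classical solution with zero past, and
`energy_identity` on a cone of propagation applies (`eq_zero_of_waveOp_eq_zero`).

Hence `□φ ↦ (φ, ∇ₓφ, φ|Γ)` extends to a bounded operator `solutionOp` on all of `L²`. Its first
component solves the direct problem, by passing to the limit in the symmetry of □; its last
component `R` (`traceOp`) is the trace. The identity `⟨□φ, R*V⟩ = ⟨φ|Γ, V⟩` says exactly that `R*V`
is the weak solution of the time-reversed problem, so the surface source is treated by
transposition.

With `M f = λ f` extended by zero, the forward operator is `F = R M`. Therefore `F* = M* R*`, where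
`M*` multiplies by `λ` and integrates in time (`adjoint_sourceOp`). The derivative of the functional
is that of a squared norm composed with an affine map. -/

noncomputable section

namespace InverseSource

/-! ### Directional derivatives in space-time -/

section Calculus

variable {n : ℕ}

/-- The derivative of `w` in the space-time direction `v`. -/
def dirDeriv (v : Space n × ℝ) (w : Space n × ℝ → ℝ) (p : Space n × ℝ) : ℝ := fderiv ℝ w p v

/-- The time direction. -/
def eT (n : ℕ) : Space n × ℝ := (0, 1)

/-- The spatial coordinate directions. -/
def eX (i : Fin n) : Space n × ℝ := (EuclideanSpace.single i 1, 0)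

instance : Measure.IsAddHaarMeasure (volume : Measure (Space n × ℝ)) :=
  inferInstanceAs (Measure.IsAddHaarMeasure
    ((volume : Measure (Space n)).prod (volume : Measure ℝ)))

lemma contDiff_dirDeriv {w : Space n × ℝ → ℝ} (hw : ContDiff ℝ ∞ w) (v : Space n × ℝ) :
    ContDiff ℝ ∞ (dirDeriv v w) :=
  (hw.fderiv_right (m := ∞) (by simp)).clm_apply contDiff_const

lemma dirDeriv_comm {w : Space n × ℝ → ℝ} (hw : ContDiff ℝ ∞ w) (u v : Space n × ℝ)
    (p : Space n × ℝ) : dirDeriv u (dirDeriv v w) p = dirDeriv v (dirDeriv u w) p := by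
  have h1 : ContDiff ℝ ∞ (fderiv ℝ w) := hw.fderiv_right (m := ∞) (by simp)
  have h2 : ∀ a b : Space n × ℝ, dirDeriv a (dirDeriv b w) p = fderiv ℝ (fderiv ℝ w) p a b := by
    intro a b
    have : HasFDerivAt (fun q => fderiv ℝ w q b) _ p :=
      ((h1.differentiable (by simp)).differentiableAt.hasFDerivAt).clm_apply
        (hasFDerivAt_const b p)
    simp only [dirDeriv]
    rw [show (dirDeriv b w) = fun q => fderiv ℝ w q b from rfl, this.fderiv]
    simp
  rw [h2, h2]
  exact (hw.contDiffAt.isSymmSndFDerivAt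
    (by simpa using (mod_cast le_top : ((2 : ℕ∞) : WithTop ℕ∞) ≤ ((⊤ : ℕ∞) : WithTop ℕ∞)))).eq u v

lemma dirDeriv_mul {f g : Space n × ℝ → ℝ} (hf : ContDiff ℝ ∞ f) (hg : ContDiff ℝ ∞ g)
    (v p : Space n × ℝ) :
    dirDeriv v (fun q => f q * g q) p = f p * dirDeriv v g p + dirDeriv v f p * g p := by
  have := (hf.differentiable (by simp) p).hasFDerivAt.mul (hg.differentiable (by simp) p).hasFDerivAt
  simp only [dirDeriv]
  rw [show (fun q => f q * g q) = f * g from rfl, this.fderiv]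
  simp; ring

lemma dirDeriv_eq_zero_of_eventuallyEq {w : Space n × ℝ → ℝ} {p : Space n × ℝ}
    (h : w =ᶠ[𝓝 p] 0) (v : Space n × ℝ) : dirDeriv v w p = 0 := by
  simp [dirDeriv, h.fderiv_eq]

lemma tsupport_dirDeriv_subset (w : Space n × ℝ → ℝ) (v : Space n × ℝ) :
    tsupport (dirDeriv v w) ⊆ tsupport w :=
  tsupport_fderiv_apply_subset ℝ v

lemma fderiv_slice_fst {w : Space n × ℝ → ℝ} (hw : ContDiff ℝ ∞ w) (p : Space n × ℝ)
    (y : Space n) : fderiv ℝ (fun x => w (x, p.2)) p.1 y = dirDeriv (y, 0) w p := by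
  have h1 : HasFDerivAt (fun x : Space n => (x, p.2)) (ContinuousLinearMap.inl ℝ (Space n) ℝ) p.1 :=
    hasFDerivAt_prodMk_left p.1 p.2
  have h2 : HasFDerivAt w (fderiv ℝ w p) (p.1, p.2) :=
    (hw.differentiable (by simp) p).hasFDerivAt
  have h3 : HasFDerivAt (fun x => w (x, p.2)) _ p.1 := h2.comp p.1 h1
  rw [h3.fderiv]
  simp [dirDeriv]

lemma hasDerivAt_slice_snd {w : Space n × ℝ → ℝ} (hw : ContDiff ℝ ∞ w) (x : Space n) (t : ℝ) :
    HasDerivAt (fun s => w (x, s)) (dirDeriv (eT n) w (x, t)) t := by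
  have h1 : HasFDerivAt (fun s : ℝ => (x, s)) (ContinuousLinearMap.inr ℝ (Space n) ℝ) t :=
    hasFDerivAt_prodMk_right x t
  have h2 : HasFDerivAt w (fderiv ℝ w (x, t)) (x, t) :=
    (hw.differentiable (by simp) _).hasFDerivAt
  have h3 : HasDerivAt (fun s => w (x, s)) _ t := (h2.comp t h1).hasDerivAt
  convert h3 using 1
  simp [dirDeriv, eT]

lemma contDiff_slice_fst {w : Space n × ℝ → ℝ} (hw : ContDiff ℝ ∞ w) (t : ℝ) :
    ContDiff ℝ ∞ (fun x => w (x, t)) :=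
  hw.comp (contDiff_id.prodMk contDiff_const)

/-- Replaces derivatives of slices by iterated directional derivatives in space-time, for which
product rule, symmetry and integration by parts have one uniform form. -/
lemma waveOp_eq (c : ℝ) {w : Space n × ℝ → ℝ} (hw : ContDiff ℝ ∞ w) (p : Space n × ℝ) :
    waveOp c w p = 1 / c ^ 2 * dirDeriv (eT n) (dirDeriv (eT n) w) p
      - ∑ i, dirDeriv (eX i) (dirDeriv (eX i) w) p := by
  unfold waveOp
  congr 2
  · rw [iteratedDeriv_succ, iteratedDeriv_one]
    have : deriv (fun t => w (p.1, t)) = fun t => dirDeriv (eT n) w (p.1, t) := by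
      ext t; exact (hasDerivAt_slice_snd hw p.1 t).deriv
    rw [this, (hasDerivAt_slice_snd (contDiff_dirDeriv hw _) p.1 p.2).deriv]
  · rw [InnerProductSpace.laplacian_eq_iteratedFDeriv_orthonormalBasis _
      (EuclideanSpace.basisFun (Fin n) ℝ)]
    refine Finset.sum_congr rfl fun i _ => ?_
    rw [iteratedFDeriv_two_apply]
    have h1 : ContDiff ℝ ∞ (fderiv ℝ (fun x => w (x, p.2))) :=
      (contDiff_slice_fst hw p.2).fderiv_right (m := ∞) (by simp)
    have h2 : HasFDerivAt (fun q => fderiv ℝ (fun x => w (x, p.2)) q (EuclideanSpace.single i 1)) _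
        p.1 := ((h1.differentiable (by simp)).differentiableAt.hasFDerivAt).clm_apply
        (hasFDerivAt_const _ p.1)
    have h3 : (fun q => fderiv ℝ (fun x => w (x, p.2)) q (EuclideanSpace.single i 1))
        = fun q => dirDeriv (eX i) w (q, p.2) := by
      ext q; exact fderiv_slice_fst hw (q, p.2) _
    have h4 := fderiv_slice_fst (contDiff_dirDeriv hw (eX i)) p (EuclideanSpace.single i 1)
    rw [← h3, h2.fderiv] at h4
    simpa [eX] using h4

lemma inner_gradX {w : Space n × ℝ → ℝ} (hw : ContDiff ℝ ∞ w) (p : Space n × ℝ) (y : Space n) :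
    inner ℝ (gradX w p) y = dirDeriv (y, 0) w p := by
  rw [gradX, gradient, InnerProductSpace.toDual_symm_apply, fderiv_slice_fst hw]

lemma gradX_apply {w : Space n × ℝ → ℝ} (hw : ContDiff ℝ ∞ w) (p : Space n × ℝ) (i : Fin n) :
    gradX w p i = dirDeriv (eX i) w p := by
  have := inner_gradX hw p (EuclideanSpace.single i 1)
  rw [EuclideanSpace.inner_single_right] at this
  simpa [eX] using this

lemma norm_gradX_sq {w : Space n × ℝ → ℝ} (hw : ContDiff ℝ ∞ w) (p : Space n × ℝ) :
    ‖gradX w p‖ ^ 2 = ∑ i, dirDeriv (eX i) w p ^ 2 := by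
  rw [EuclideanSpace.real_norm_sq_eq]
  exact Finset.sum_congr rfl fun i _ => by rw [gradX_apply hw]

/-- Before time `a` the function vanishes locally; at time `a` itself the derivative is a left limit
of zeros. This provides zero Cauchy data at the bottom of a slab. -/
lemma dirDeriv_eq_zero_of_le {w : Space n × ℝ → ℝ} (hw : ContDiff ℝ ∞ w) {a : ℝ}
    (h0 : ∀ p : Space n × ℝ, p.2 ≤ a → w p = 0) (v p : Space n × ℝ) (hp : p.2 ≤ a) :
    dirDeriv v w p = 0 := by
  have h1 : ∀ q : Space n × ℝ, q.2 < a → dirDeriv v w q = 0 := by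
    intro q hq
    refine dirDeriv_eq_zero_of_eventuallyEq ?_ v
    filter_upwards [(isOpen_lt continuous_snd continuous_const).mem_nhds hq] with r hr
    exact h0 r (le_of_lt hr)
  have hc : Continuous fun s : ℝ => dirDeriv v w (p.1, s) :=
    (contDiff_dirDeriv hw v).continuous.comp (by fun_prop)
  have h2 : Tendsto (fun s : ℝ => dirDeriv v w (p.1, s)) (𝓝[<] p.2) (𝓝 (dirDeriv v w p)) :=
    hc.continuousAt.tendsto.mono_left nhdsWithin_le_nhds
  refine tendsto_nhds_unique h2 (tendsto_const_nhds.congr' ?_)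
  filter_upwards [self_mem_nhdsWithin] with s hs
  exact (h1 _ (lt_of_lt_of_le hs hp)).symm

end Calculus

/-! ### Integration by parts on a slab -/

section Slab

variable {n : ℕ}

/-- `F` vanishes for large `x`, uniformly for times after `a - 1`. -/
def SpatiallyBounded (a : ℝ) (F : Space n × ℝ → ℝ) : Prop :=
  ∃ R : ℝ, ∀ p : Space n × ℝ, R < ‖p.1‖ → a - 1 < p.2 → F p = 0

lemma SpatiallyBounded.mul_right {a : ℝ} {F : Space n × ℝ → ℝ} (hF : SpatiallyBounded a F)
    (G : Space n × ℝ → ℝ) : SpatiallyBounded a (fun p => F p * G p) := by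
  obtain ⟨R, hR⟩ := hF
  exact ⟨R, fun p h1 h2 => by simp [hR p h1 h2]⟩

/-- The margin `a - 1` leaves an open set of times around `[a, ∞)`, so the property passes to
derivatives at time `a` too. -/
lemma SpatiallyBounded.dirDeriv {a : ℝ} {F : Space n × ℝ → ℝ} (hF : SpatiallyBounded a F)
    (v : Space n × ℝ) : SpatiallyBounded a (dirDeriv v F) := by
  obtain ⟨R, hR⟩ := hF
  refine ⟨R, fun p h1 h2 => dirDeriv_eq_zero_of_eventuallyEq ?_ v⟩
  filter_upwards [(isOpen_lt continuous_const (by fun_prop : Continuous fun q : Space n × ℝ =>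
    ‖q.1‖)).mem_nhds h1, (isOpen_lt continuous_const continuous_snd).mem_nhds h2] with q h3 h4
  exact hR q h3 h4

lemma SpatiallyBounded.integrableOn {a b : ℝ} {F : Space n × ℝ → ℝ} (hF : SpatiallyBounded a F)
    (hc : Continuous F) : IntegrableOn F (univ ×ˢ Ioc a b) := by
  obtain ⟨R, hR⟩ := hF
  have h1 : IntegrableOn F (Metric.closedBall 0 R ×ˢ Icc a b) :=
    hc.continuousOn.integrableOn_compact ((isCompact_closedBall 0 R).prod isCompact_Icc)
  refine h1.of_forall_sdiff_eq_zero (MeasurableSet.univ.prod measurableSet_Ioc) ?_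
  rintro ⟨x, t⟩ ⟨h2, h3⟩
  simp only [mem_prod, mem_univ, mem_Ioc, true_and, Metric.mem_closedBall, dist_zero_right,
    mem_Icc, not_and] at h2 h3
  refine hR _ ?_ (by simp; linarith)
  by_contra h
  exact h3 (not_lt.1 h) h2.1.le h2.2

lemma integral_slab_dirDeriv_time {a b : ℝ} (hab : a ≤ b) {F : Space n × ℝ → ℝ}
    (hF : SpatiallyBounded a F) (hs : ContDiff ℝ ∞ F) (ha : ∀ x, F (x, a) = 0)
    (hb : ∀ x, F (x, b) = 0) : ∫ p in univ ×ˢ Ioc a b, dirDeriv (eT n) F p = 0 := by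
  rw [Measure.volume_eq_prod, setIntegral_prod]
  · refine (integral_congr_ae (Eventually.of_forall fun x => ?_)).trans (integral_zero _ _)
    rw [← intervalIntegral.integral_of_le hab,
      intervalIntegral.integral_eq_sub_of_hasDerivAt (fun t _ => hasDerivAt_slice_snd hs x t)]
    · simp [ha, hb]
    · exact ((contDiff_dirDeriv hs _).continuous.comp (by fun_prop)).intervalIntegrable _ _
  · exact (hF.dirDeriv _).integrableOn (contDiff_dirDeriv hs _).continuous

lemma integral_slab_dirDeriv_space {a b : ℝ} {F : Space n × ℝ → ℝ}
    (hF : SpatiallyBounded a F) (hs : ContDiff ℝ ∞ F) (i : Fin n) :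
    ∫ p in univ ×ˢ Ioc a b, dirDeriv (eX i) F p = 0 := by
  have hint := (hF.dirDeriv (eX i)).integrableOn (b := b) (contDiff_dirDeriv hs (eX i)).continuous
  rw [Measure.volume_eq_prod] at hint ⊢
  rw [IntegrableOn, ← Measure.prod_restrict] at hint
  rw [← Measure.prod_restrict, integral_prod_symm _ hint]
  refine (setIntegral_congr_fun measurableSet_Ioc fun t ht => ?_).trans
    (integral_zero _ _)
  obtain ⟨R, hR⟩ := hF
  have hcs : ContDiff ℝ ∞ fun x => F (x, t) := contDiff_slice_fst hs t
  have hsupp : HasCompactSupport fun x => F (x, t) := by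
    refine HasCompactSupport.intro (isCompact_closedBall 0 R) fun x hx => hR _ ?_ ?_
    · simpa using hx
    · have := ht.1; dsimp only; linarith
  -- Integration by parts against the constant 1: the integral of a derivative of a compactly
  -- supported slice is zero.
  have h1 := integral_mul_fderiv_eq_neg_fderiv_mul_of_integrable (μ := (volume : Measure (Space n)))
    (f := fun _ => (1 : ℝ)) (g := fun x => F (x, t)) (v := EuclideanSpace.single i 1)
    (by simp) (by
      simp only [one_mul]
      exact ((hcs.continuous_fderiv (by simp)).clm_apply continuous_const).integrable_of_hasCompactSupport
        (hsupp.fderiv_apply (𝕜 := ℝ) _))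
    (by simpa using hcs.continuous.integrable_of_hasCompactSupport hsupp)
    (fun x _ => by fun_prop) (fun x _ => hcs.differentiable (by simp) x)
  simp only [one_mul] at h1
  rw [Measure.restrict_univ]
  calc _ = ∫ x, fderiv ℝ (fun x => F (x, t)) x (EuclideanSpace.single i 1) :=
        integral_congr_ae (Eventually.of_forall fun x => (fderiv_slice_fst hs (x, t) _).symm)
    _ = 0 := by rw [h1]; simp

/-- The energy density of the wave equation. -/
def energy (c : ℝ) (w : Space n × ℝ → ℝ) (p : Space n × ℝ) : ℝ :=
  1 / 2 * (1 / c ^ 2 * dirDeriv (eT n) w p ^ 2 + ∑ i, dirDeriv (eX i) w p ^ 2)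

lemma contDiff_energy (c : ℝ) {w : Space n × ℝ → ℝ} (hw : ContDiff ℝ ∞ w) :
    ContDiff ℝ ∞ (energy c w) := by
  have := contDiff_dirDeriv hw
  unfold energy
  exact contDiff_const.mul ((contDiff_const.mul ((this _).pow 2)).add
    (ContDiff.sum fun i _ => (this _).pow 2))

lemma dirDeriv_energy (c : ℝ) {w : Space n × ℝ → ℝ} (hw : ContDiff ℝ ∞ w) (v p : Space n × ℝ) :
    dirDeriv v (energy c w) p = 1 / c ^ 2 * (dirDeriv (eT n) w p * dirDeriv v (dirDeriv (eT n) w) p)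
      + ∑ i, dirDeriv (eX i) w p * dirDeriv v (dirDeriv (eX i) w) p := by
  have h : ∀ u, HasFDerivAt (dirDeriv u w) (fderiv ℝ (dirDeriv u w) p) p := fun u =>
    ((contDiff_dirDeriv hw u).differentiable (by simp) p).hasFDerivAt
  have h2 : HasFDerivAt (energy c w) _ p :=
    ((((h (eT n)).pow 2).const_mul (1 / c ^ 2)).add
      (HasFDerivAt.fun_sum (u := Finset.univ) fun i _ => (h (eX i)).pow 2)).const_mul (1 / 2)
  rw [dirDeriv, h2.fderiv]
  simp [dirDeriv, Finset.mul_sum]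
  congr 1
  · ring
  · exact Finset.sum_congr rfl fun i _ => by ring

/-- The weighted energy identity. -/
lemma energy_identity (c : ℝ) {a b : ℝ} (hab : a ≤ b) {w ζ : Space n × ℝ → ℝ}
    (hw : ContDiff ℝ ∞ w) (hζ : ContDiff ℝ ∞ ζ) (hζs : SpatiallyBounded a ζ)
    (hζb : ∀ x, ζ (x, b) = 0) (hw0 : ∀ p : Space n × ℝ, p.2 ≤ a → w p = 0) :
    ∫ p in univ ×ˢ Ioc a b, ζ p * (dirDeriv (eT n) w p * waveOp c w p)
      = ∫ p in univ ×ˢ Ioc a b, (- dirDeriv (eT n) ζ p * energy c w p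
          + ∑ i, dirDeriv (eX i) ζ p * (dirDeriv (eT n) w p * dirDeriv (eX i) w p)) := by
  have hd := contDiff_dirDeriv hw
  have hT : ContDiff ℝ ∞ fun p => ζ p * energy c w p := hζ.mul (contDiff_energy c hw)
  have hX : ∀ i : Fin n, ContDiff ℝ ∞ fun p => ζ p * (dirDeriv (eT n) w p * dirDeriv (eX i) w p) :=
    fun i => hζ.mul ((hd _).mul (hd _))
  have hsT := hζs.mul_right (energy c w)
  have hsX : ∀ i : Fin n,
      SpatiallyBounded a fun p => ζ p * (dirDeriv (eT n) w p * dirDeriv (eX i) w p) :=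
    fun i => hζs.mul_right _
  have iT := (hsT.dirDeriv (eT n)).integrableOn (b := b) (contDiff_dirDeriv hT _).continuous
  have iX := fun i => ((hsX i).dirDeriv (eX i)).integrableOn (b := b)
    (contDiff_dirDeriv (hX i) _).continuous
  have hdζ := contDiff_dirDeriv hζ
  have iR : IntegrableOn (fun p => - dirDeriv (eT n) ζ p * energy c w p
          + ∑ i, dirDeriv (eX i) ζ p * (dirDeriv (eT n) w p * dirDeriv (eX i) w p))
      (univ ×ˢ Ioc a b) := by
    refine Integrable.add ?_ (integrable_finsetSum _ fun i _ => ?_)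
    · simp only [neg_mul]
      exact (((hζs.dirDeriv _).mul_right _).integrableOn
        ((hdζ _).mul (contDiff_energy c hw)).continuous).neg
    · exact ((hζs.dirDeriv _).mul_right _).integrableOn
        ((hdζ _).mul ((hd _).mul (hd _))).continuous
  -- The conservation law `∂ₜw □w = ∂ₜe - div(∂ₜw ∇w)`, multiplied by `ζ`: two full derivatives plus
  -- the terms in which `ζ` is differentiated.
  have key : ∀ p, ζ p * (dirDeriv (eT n) w p * waveOp c w p)
      = dirDeriv (eT n) (fun p => ζ p * energy c w p) p
        - ∑ i, dirDeriv (eX i) (fun p => ζ p * (dirDeriv (eT n) w p * dirDeriv (eX i) w p)) p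
        + (- dirDeriv (eT n) ζ p * energy c w p
          + ∑ i, dirDeriv (eX i) ζ p * (dirDeriv (eT n) w p * dirDeriv (eX i) w p)) := by
    intro p
    rw [dirDeriv_mul hζ (contDiff_energy c hw), dirDeriv_energy c hw, waveOp_eq c hw]
    have : ∀ i : Fin n, dirDeriv (eX i) (fun p => ζ p * (dirDeriv (eT n) w p * dirDeriv (eX i) w p)) p
        = ζ p * (dirDeriv (eT n) w p * dirDeriv (eX i) (dirDeriv (eX i) w) p)
          + ζ p * (dirDeriv (eX i) w p * dirDeriv (eT n) (dirDeriv (eX i) w) p)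
          + dirDeriv (eX i) ζ p * (dirDeriv (eT n) w p * dirDeriv (eX i) w p) := by
      intro i
      rw [dirDeriv_mul hζ ((hd _).mul (hd _)), dirDeriv_mul (hd _) (hd _),
        dirDeriv_comm hw (eX i) (eT n)]
      ring
    simp only [this, Finset.sum_add_distrib, ← Finset.mul_sum]
    ring
  simp_rw [key]
  have iS : Integrable (fun p => ∑ i, dirDeriv (eX i)
      (fun p => ζ p * (dirDeriv (eT n) w p * dirDeriv (eX i) w p)) p)
      (volume.restrict (univ ×ˢ Ioc a b)) := integrable_finsetSum _ fun i _ => iX i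
  have hsub := integral_add (iT.sub iS) iR
  simp only [Pi.sub_apply] at hsub
  -- The full derivatives integrate to zero: at time `b` because of `ζ`, at time `a` because the
  -- energy of `w` vanishes there, and laterally because `ζ` is spatially bounded.
  rw [hsub, integral_sub iT iS,
    integral_finsetSum _ fun i _ => iX i,
    integral_slab_dirDeriv_time hab hsT hT (fun x => ?_) (fun x => by simp [hζb]),
    Finset.sum_eq_zero fun i _ => integral_slab_dirDeriv_space (hsX i) (hX i) i]
  · simp
  · have := fun v => dirDeriv_eq_zero_of_le hw hw0 v (x, a) le_rfl
    simp [energy, this]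

end Slab

/-! ### Energy estimates -/

section Estimates

variable {n : ℕ}

lemma dirDeriv_eq_zero_of_notMem_tsupport {w : Space n × ℝ → ℝ} {p : Space n × ℝ}
    (hp : p ∉ tsupport w) (v : Space n × ℝ) : dirDeriv v w p = 0 :=
  image_eq_zero_of_notMem_tsupport fun h => hp (tsupport_dirDeriv_subset w v h)

lemma isTest_dirDeriv {φ : Space n × ℝ → ℝ} (hφ : IsTest φ) (v : Space n × ℝ) :
    IsTest (dirDeriv v φ) :=
  ⟨contDiff_dirDeriv hφ.1 v, hφ.2.fderiv_apply (𝕜 := ℝ) v⟩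

lemma spatiallyBounded_of_hasCompactSupport {F : Space n × ℝ → ℝ} (hF : HasCompactSupport F)
    (a : ℝ) : SpatiallyBounded a F := by
  obtain ⟨R, hR⟩ := hF.isBounded.subset_closedBall 0
  refine ⟨R, fun p hp _ => image_eq_zero_of_notMem_tsupport fun h => ?_⟩
  have := hR h
  rw [mem_closedBall_zero_iff] at this
  exact absurd ((norm_fst_le p).trans this) (not_le.2 hp)

lemma contDiff_waveOp (c : ℝ) {w : Space n × ℝ → ℝ} (hw : ContDiff ℝ ∞ w) :
    ContDiff ℝ ∞ (waveOp c w) := by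
  rw [show waveOp c w = _ from funext (waveOp_eq c hw)]
  have h := fun v => contDiff_dirDeriv (contDiff_dirDeriv hw v) v
  exact (contDiff_const.mul (h _)).sub (ContDiff.sum fun i _ => h _)

lemma waveOp_eq_zero_of_notMem_tsupport (c : ℝ) {w : Space n × ℝ → ℝ} (hw : ContDiff ℝ ∞ w)
    {p : Space n × ℝ} (hp : p ∉ tsupport w) : waveOp c w p = 0 := by
  have h : ∀ v, dirDeriv v (dirDeriv v w) p = 0 := fun v =>
    dirDeriv_eq_zero_of_notMem_tsupport (fun h => hp (tsupport_dirDeriv_subset w v h)) v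
  rw [waveOp_eq c hw]
  simp [h]

lemma isTest_waveOp (c : ℝ) {φ : Space n × ℝ → ℝ} (hφ : IsTest φ) : IsTest (waveOp c φ) :=
  ⟨contDiff_waveOp c hφ.1, HasCompactSupport.intro hφ.2 fun _ hp =>
    waveOp_eq_zero_of_notMem_tsupport c hφ.1 hp⟩

lemma dirDeriv_eT_sub (b : ℝ) (p : Space n × ℝ) :
    dirDeriv (eT n) (fun q => b - q.2) p = -1 := by
  have : HasFDerivAt (fun q : Space n × ℝ => b - q.2) (-ContinuousLinearMap.snd ℝ (Space n) ℝ) p :=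
    hasFDerivAt_snd.const_sub b
  simp [dirDeriv, this.fderiv, eT]

lemma dirDeriv_eX_sub (b : ℝ) (i : Fin n) (p : Space n × ℝ) :
    dirDeriv (eX i) (fun q => b - q.2) p = 0 := by
  have : HasFDerivAt (fun q : Space n × ℝ => b - q.2) (-ContinuousLinearMap.snd ℝ (Space n) ℝ) p :=
    hasFDerivAt_snd.const_sub b
  simp [dirDeriv, this.fderiv, eX]

lemma eq_zero_of_tsupport_subset_Ioi {φ : Space n × ℝ → ℝ} {a : ℝ}
    (h0 : tsupport φ ⊆ univ ×ˢ Ioi a) (p : Space n × ℝ) (hp : p.2 ≤ a) : φ p = 0 :=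
  image_eq_zero_of_notMem_tsupport fun h => not_lt.2 hp (h0 h).2

/-- The weight `T - t` has time derivative `-1` and vanishes at `T`, so the identity yields the
energy integrated over the whole slab with no term at the final time. -/
lemma integral_energy_eq (c : ℝ) {T : ℝ} (hT : 0 < T) {φ : Space n × ℝ → ℝ} (hφ : IsTest φ)
    (h0 : tsupport φ ⊆ univ ×ˢ Ioi 0) :
    ∫ p, energy c φ p ∂slab n T
      = ∫ p, (T - p.2) * (dirDeriv (eT n) φ p * waveOp c φ p) ∂slab n T := by
  obtain ⟨R, hR0, hR⟩ := hφ.2.isBounded.subset_closedBall_lt 0 0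
  -- `T - t` does not vanish for large `x`; the cutoff equals 1 in a neighbourhood of the support of
  -- `φ`, so it and its derivatives never show.
  let χ : ContDiffBump (0 : Space n × ℝ) := ⟨R + 1, R + 2, by linarith, by linarith⟩
  have hχ : ContDiff ℝ ∞ χ := χ.contDiff
  have hl : ContDiff ℝ ∞ fun q : Space n × ℝ => T - q.2 := by fun_prop
  have hζ : ContDiff ℝ ∞ fun q : Space n × ℝ => (T - q.2) * χ q := hl.mul hχ
  have hζs : SpatiallyBounded 0 fun q : Space n × ℝ => (T - q.2) * χ q :=
    spatiallyBounded_of_hasCompactSupport χ.hasCompactSupport.mul_left 0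
  have key := energy_identity c hT.le hφ.1 hζ hζs (by simp)
    (fun p hp => eq_zero_of_tsupport_subset_Ioi h0 p hp)
  have hloc : ∀ p ∈ tsupport φ, (fun q : Space n × ℝ => (T - q.2) * χ q) =ᶠ[𝓝 p]
      fun q => T - q.2 := by
    intro p hp
    have : p ∈ Metric.ball (0 : Space n × ℝ) (R + 1) :=
      Metric.closedBall_subset_ball (by linarith) (hR hp)
    filter_upwards [Metric.isOpen_ball.mem_nhds this] with q hq
    rw [χ.one_of_mem_closedBall (Metric.ball_subset_closedBall hq), mul_one]
  refine (Eq.trans ?_ key.symm).trans ?_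
  · refine integral_congr_ae (Eventually.of_forall fun p => ?_)
    by_cases hp : p ∈ tsupport φ
    · simp only [dirDeriv, (hloc p hp).fderiv_eq]
      have h1 := dirDeriv_eT_sub T p
      have h2 := fun i => dirDeriv_eX_sub T i p
      simp only [dirDeriv] at h1 h2
      simp [h1, h2]
    · simp [energy, dirDeriv_eq_zero_of_notMem_tsupport hp]
  · refine integral_congr_ae (Eventually.of_forall fun p => ?_)
    by_cases hp : p ∈ tsupport φ
    · simp only [(hloc p hp).self_of_nhds]
    · simp [dirDeriv_eq_zero_of_notMem_tsupport hp]

lemma continuous_integrable_slab {T : ℝ} {F : Space n × ℝ → ℝ} (hF : Continuous F)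
    (hs : HasCompactSupport F) : Integrable F (slab n T) :=
  (hF.integrable_of_hasCompactSupport hs).restrict

lemma isTest_mul {F G : Space n × ℝ → ℝ} (hF : IsTest F) (hG : ContDiff ℝ ∞ G) :
    IsTest fun p => F p * G p := ⟨hF.1.mul hG, hF.2.mul_right⟩

lemma IsTest.integrable_slab {T : ℝ} {F : Space n × ℝ → ℝ} (hF : IsTest F) :
    Integrable F (slab n T) := continuous_integrable_slab hF.1.continuous hF.2

lemma IsTest.integrable_sq {T : ℝ} {F : Space n × ℝ → ℝ} (hF : IsTest F) :
    Integrable (fun p => F p ^ 2) (slab n T) := by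
  simpa [sq] using (isTest_mul hF hF.1).integrable_slab

lemma isTest_energy (c : ℝ) {φ : Space n × ℝ → ℝ} (hφ : IsTest φ) : IsTest (energy c φ) :=
  ⟨contDiff_energy c hφ.1, HasCompactSupport.intro hφ.2 fun p hp => by
    simp [energy, dirDeriv_eq_zero_of_notMem_tsupport hp]⟩

lemma integral_slab_mono {T : ℝ} {F G : Space n × ℝ → ℝ} (hF : Integrable F (slab n T))
    (hG : Integrable G (slab n T)) (h : ∀ p : Space n × ℝ, 0 < p.2 → p.2 ≤ T → F p ≤ G p) :
    ∫ p, F p ∂slab n T ≤ ∫ p, G p ∂slab n T :=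
  setIntegral_mono_on hF hG (MeasurableSet.univ.prod measurableSet_Ioc)
    fun p hp => h p hp.2.1 hp.2.2

/-- The energy estimate. -/
lemma integral_energy_le {c T : ℝ} (hc : 0 < c) (hT : 0 < T) {φ : Space n × ℝ → ℝ}
    (hφ : IsTest φ) (h0 : tsupport φ ⊆ univ ×ˢ Ioi 0) :
    ∫ p, energy c φ p ∂slab n T ≤ 2 * c ^ 2 * T ^ 2 * ∫ p, waveOp c φ p ^ 2 ∂slab n T := by
  have hq := (isTest_waveOp c hφ).integrable_sq (T := T)
  have he := (isTest_energy c hφ).integrable_slab (T := T)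
  have h1 := integral_energy_eq c hT hφ h0
  -- Young's inequality for `(A/c) · (c (T - t) B)` with weights `1/4` and `1`. The first square is
  -- at most half the energy, which is absorbed on the left and doubles the constant.
  have h2 : ∫ p, (T - p.2) * (dirDeriv (eT n) φ p * waveOp c φ p) ∂slab n T
      ≤ ∫ p, (1 / 2 * energy c φ p + c ^ 2 * T ^ 2 * waveOp c φ p ^ 2) ∂slab n T := by
    refine integral_slab_mono ?_ ((he.const_mul _).add (hq.const_mul _)) fun p hp0 hpT => ?_
    · have := isTest_mul (isTest_mul (isTest_dirDeriv hφ (eT n)) (contDiff_waveOp c hφ.1))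
        (by fun_prop : ContDiff ℝ ∞ fun q : Space n × ℝ => T - q.2)
      refine this.integrable_slab.congr (Eventually.of_forall fun p => by dsimp only; ring)
    · set A := dirDeriv (eT n) φ p
      set B := waveOp c φ p
      have hs : 0 ≤ ∑ i, dirDeriv (eX i) φ p ^ 2 := Finset.sum_nonneg fun i _ => sq_nonneg _
      have hA : 1 / 4 * (A / c) ^ 2 ≤ 1 / 2 * energy c φ p := by
        have : (A / c) ^ 2 = 1 / c ^ 2 * A ^ 2 := by field_simp
        rw [this]; simp only [energy]; linarith
      have h3 : (T - p.2) * (A * B) = (A / c) * (c * (T - p.2) * B) := by field_simp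
      have h4 : (c * (T - p.2) * B) ^ 2 ≤ c ^ 2 * T ^ 2 * B ^ 2 := by
        have : (T - p.2) ^ 2 ≤ T ^ 2 := by nlinarith
        rw [mul_pow, mul_pow]; gcongr
      rw [h3]
      nlinarith [sq_nonneg (1 / 2 * (A / c) - c * (T - p.2) * B)]
  rw [integral_add (he.const_mul _) (hq.const_mul _), integral_const_mul, integral_const_mul] at h2
  linarith

/-- `(T - t) φ²` vanishes at both ends, so its time derivative integrates to zero and `∫ φ² = 2 ∫ (T
- t) φ ∂ₜφ`; Young's inequality absorbs half of the left side. -/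
lemma integral_sq_le {T : ℝ} (hT : 0 < T) {φ : Space n × ℝ → ℝ}
    (hφ : IsTest φ) (h0 : tsupport φ ⊆ univ ×ˢ Ioi 0) :
    ∫ p, φ p ^ 2 ∂slab n T ≤ 4 * T ^ 2 * ∫ p, dirDeriv (eT n) φ p ^ 2 ∂slab n T := by
  have hl : ContDiff ℝ ∞ fun q : Space n × ℝ => T - q.2 := by fun_prop
  have hs := isTest_mul (isTest_mul hφ hφ.1) hl
  have h1 : ∫ p, dirDeriv (eT n) (fun p => φ p * φ p * (T - p.2)) p ∂slab n T = 0 :=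
    integral_slab_dirDeriv_time hT.le (spatiallyBounded_of_hasCompactSupport hs.2 0) hs.1
      (fun x => by simp [eq_zero_of_tsupport_subset_Ioi h0 (x, 0) le_rfl]) (by simp)
  have h2 : ∀ p, dirDeriv (eT n) (fun p => φ p * φ p * (T - p.2)) p
      = 2 * (T - p.2) * φ p * dirDeriv (eT n) φ p - φ p ^ 2 := by
    intro p
    rw [dirDeriv_mul (hφ.1.mul hφ.1) hl, dirDeriv_mul hφ.1 hφ.1, dirDeriv_eT_sub]
    ring
  have i1 := hφ.integrable_sq (T := T)
  have i2 := (isTest_dirDeriv hφ (eT n)).integrable_sq (T := T)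
  have i3 := (isTest_dirDeriv hs (eT n)).integrable_slab (T := T)
  have h4 : ∫ p, dirDeriv (eT n) (fun p => φ p * φ p * (T - p.2)) p ∂slab n T
      ≤ ∫ p, (2 * T ^ 2 * dirDeriv (eT n) φ p ^ 2 - 1 / 2 * φ p ^ 2) ∂slab n T := by
    refine integral_slab_mono i3 ((i2.const_mul _).sub (i1.const_mul _)) fun p hp0 hpT => ?_
    rw [h2]
    have h5 : ((T - p.2) * dirDeriv (eT n) φ p) ^ 2 ≤ T ^ 2 * dirDeriv (eT n) φ p ^ 2 := by
      have : (T - p.2) ^ 2 ≤ T ^ 2 := by nlinarith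
      rw [mul_pow]; gcongr
    nlinarith [sq_nonneg (φ p - 2 * ((T - p.2) * dirDeriv (eT n) φ p))]
  rw [h1, integral_sub (i2.const_mul _) (i1.const_mul _), integral_const_mul,
    integral_const_mul] at h4
  linarith

/-- Solutions of the wave equation are controlled by their sources, in `L²(0,T; H¹)`. -/
lemma exists_wave_estimate {c T : ℝ} (hc : 0 < c) (hT : 0 < T) : ∃ C : ℝ, 0 ≤ C ∧
    ∀ φ : Space n × ℝ → ℝ, IsTest φ → tsupport φ ⊆ univ ×ˢ Ioi 0 →
      ∫ p, φ p ^ 2 ∂slab n T ≤ C * ∫ p, waveOp c φ p ^ 2 ∂slab n T ∧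
      ∫ p, ‖gradX φ p‖ ^ 2 ∂slab n T ≤ C * ∫ p, waveOp c φ p ^ 2 ∂slab n T := by
  -- The first summand is `4T² · 2c² · 2c²T²`, for `φ`; the second is `2 · 2c²T²`, for the gradient.
  refine ⟨16 * T ^ 4 * c ^ 4 + 4 * c ^ 2 * T ^ 2, by positivity, fun φ hφ h0 => ?_⟩
  have hE := integral_energy_le hc hT hφ h0
  have hS := integral_sq_le hT hφ h0
  have hq : 0 ≤ ∫ p, waveOp c φ p ^ 2 ∂slab n T := integral_nonneg fun p => sq_nonneg _
  have he := (isTest_energy c hφ).integrable_slab (T := T)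
  have hgi : Integrable (fun p => ∑ i, dirDeriv (eX i) φ p ^ 2) (slab n T) :=
    integrable_finsetSum _ fun i _ => (isTest_dirDeriv hφ _).integrable_sq
  have hsum : ∀ p, 0 ≤ ∑ i, dirDeriv (eX i) φ p ^ 2 := fun p =>
    Finset.sum_nonneg fun i _ => sq_nonneg _
  constructor
  · have h1 : ∫ p, dirDeriv (eT n) φ p ^ 2 ∂slab n T ≤ ∫ p, 2 * c ^ 2 * energy c φ p ∂slab n T := by
      refine integral_slab_mono (isTest_dirDeriv hφ _).integrable_sq (he.const_mul _)
        fun p _ _ => ?_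
      have : 2 * c ^ 2 * energy c φ p
          = dirDeriv (eT n) φ p ^ 2 + c ^ 2 * ∑ i, dirDeriv (eX i) φ p ^ 2 := by
        simp only [energy]; field_simp
      rw [this]
      have := mul_nonneg (sq_nonneg c) (hsum p)
      linarith
    rw [integral_const_mul] at h1
    calc _ ≤ 4 * T ^ 2 * (2 * c ^ 2 * (2 * c ^ 2 * T ^ 2 * ∫ p, waveOp c φ p ^ 2 ∂slab n T)) :=
          hS.trans (by gcongr; exact h1.trans (by gcongr))
      _ = 16 * T ^ 4 * c ^ 4 * ∫ p, waveOp c φ p ^ 2 ∂slab n T := by ring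
      _ ≤ _ := by gcongr; have : 0 ≤ 4 * c ^ 2 * T ^ 2 := by positivity
                  linarith
  · have h1 : ∫ p, ‖gradX φ p‖ ^ 2 ∂slab n T ≤ ∫ p, 2 * energy c φ p ∂slab n T := by
      simp_rw [norm_gradX_sq hφ.1]
      refine integral_slab_mono hgi (he.const_mul _) fun p _ _ => ?_
      have : 0 ≤ 1 / c ^ 2 * dirDeriv (eT n) φ p ^ 2 := by positivity
      simp only [energy]; linarith
    rw [integral_const_mul] at h1
    calc _ ≤ 2 * (2 * c ^ 2 * T ^ 2 * ∫ p, waveOp c φ p ^ 2 ∂slab n T) :=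
          h1.trans (by gcongr)
      _ = 4 * c ^ 2 * T ^ 2 * ∫ p, waveOp c φ p ^ 2 ∂slab n T := by ring
      _ ≤ _ := by gcongr; have : 0 ≤ 16 * T ^ 4 * c ^ 4 := by positivity
                  linarith

/-! ### Uniqueness by a cone argument -/

lemma dirDeriv_comp {g : ℝ → ℝ} (hg : Differentiable ℝ g) {f : Space n × ℝ → ℝ}
    (hf : ContDiff ℝ ∞ f) (v p : Space n × ℝ) :
    dirDeriv v (fun q => g (f q)) p = deriv g (f p) * dirDeriv v f p := by
  have h1 : HasFDerivAt (fun q => g (f q)) _ p :=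
    (hg (f p)).hasDerivAt.comp_hasFDerivAt p (hf.differentiable (by simp) p).hasFDerivAt
  simp [dirDeriv, h1.fderiv]

/-- The phase function of the backward cone, with a smoothened tip. -/
def conePhase (c a R : ℝ) (p : Space n × ℝ) : ℝ := R - c * (p.2 - a) - √(1 + ‖p.1‖ ^ 2)

lemma contDiff_conePhase (c a R : ℝ) : ContDiff ℝ ∞ (conePhase (n := n) c a R) := by
  have h : ContDiff ℝ ∞ fun p : Space n × ℝ => 1 + ‖p.1‖ ^ 2 :=
    contDiff_const.add (contDiff_fst.norm_sq ℝ)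
  exact (by fun_prop : ContDiff ℝ ∞ fun p : Space n × ℝ => R - c * (p.2 - a)).sub
    (h.sqrt fun p => by positivity)

lemma dirDeriv_conePhase (c a R : ℝ) (v p : Space n × ℝ) :
    dirDeriv v (conePhase c a R) p = - c * v.2 - inner ℝ p.1 v.1 / √(1 + ‖p.1‖ ^ 2) := by
  have h1 : HasFDerivAt (fun p : Space n × ℝ => 1 + ‖p.1‖ ^ 2) _ p :=
    ((hasFDerivAt_fst (𝕜 := ℝ) (E := Space n) (F := ℝ) (p := p)).norm_sq).const_add 1
  have h2 : HasFDerivAt (conePhase (n := n) c a R) _ p :=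
    (((hasFDerivAt_snd (𝕜 := ℝ) (E := Space n) (F := ℝ) (p := p)).sub_const a).const_mul c
      |>.const_sub R).sub (h1.sqrt (by positivity))
  rw [dirDeriv, h2.fderiv]
  simp
  ring

/-- Energy travels with speed at most `c`: since `x / s` has length at most 1, Cauchy–Schwarz and
`2A(cm) ≤ A² + c²m²` bound the flux in its direction by `c` times the energy density. -/
lemma cone_cross_term {ι : Type*} [Fintype ι] {c A s : ℝ} (hc : 0 < c) (x g : ι → ℝ) (hs : 0 < s)
    (hx : ∑ i, x i ^ 2 ≤ s ^ 2) :
    0 ≤ c * (1 / 2 * (1 / c ^ 2 * A ^ 2 + ∑ i, g i ^ 2)) - ∑ i, x i / s * (A * g i) := by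
  set m := ∑ i, x i / s * g i
  have h1 : ∑ i, x i / s * (A * g i) = A * m := by
    rw [Finset.mul_sum]; exact Finset.sum_congr rfl fun i _ => by ring
  have h2 : m ^ 2 ≤ ∑ i, g i ^ 2 := by
    have h3 := Finset.sum_mul_sq_le_sq_mul_sq Finset.univ (fun i => x i / s) g
    have h4 : ∑ i, (x i / s) ^ 2 ≤ 1 := by
      simp_rw [div_pow]
      rw [← Finset.sum_div, div_le_one (by positivity)]
      exact hx
    have h5 : 0 ≤ ∑ i, g i ^ 2 := Finset.sum_nonneg fun i _ => sq_nonneg _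
    nlinarith
  rw [h1]
  have h6 : c * (1 / 2 * (1 / c ^ 2 * A ^ 2 + ∑ i, g i ^ 2))
      = 1 / 2 * ((A ^ 2 + c ^ 2 * ∑ i, g i ^ 2) / c) := by field_simp
  have h7 : 2 * A * m ≤ (A ^ 2 + c ^ 2 * ∑ i, g i ^ 2) / c := by
    rw [le_div_iff₀ hc]
    nlinarith [sq_nonneg (A - c * m), mul_le_mul_of_nonneg_left h2 (sq_nonneg c)]
  rw [h6]; linarith

/-- Classical solutions of the homogeneous wave equation with zero past vanish. -/
lemma eq_zero_of_waveOp_eq_zero {c a b : ℝ} (hc : 0 < c) {w : Space n × ℝ → ℝ}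
    (hw : ContDiff ℝ ∞ w) (h0 : ∀ p : Space n × ℝ, p.2 ≤ a → w p = 0)
    (h1 : ∀ p : Space n × ℝ, p.2 < b → waveOp c w p = 0) (p : Space n × ℝ) (hp : p.2 < b) :
    w p = 0 := by
  rcases le_or_gt b a with hba | hab
  · exact h0 p (hp.le.trans hba)
  have hη : ContDiff ℝ ∞ Real.smoothTransition := Real.smoothTransition.contDiff
  have hd := contDiff_dirDeriv hw
  -- It suffices that `∂ₜw` vanishes, since `w` is zero at time `a`.
  have hTz : ∀ q : Space n × ℝ, q.2 ∈ Ioo a b → dirDeriv (eT n) w q = 0 := by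
    intro q hq
    -- With this `R` the cone phase equals 1 at `q`, so `q` lies strictly inside the cone.
    set R := c * (q.2 - a) + √(1 + ‖q.1‖ ^ 2) + 1 with hRdef
    have hκ := contDiff_conePhase (n := n) c a R
    have hl : ContDiff ℝ ∞ fun q : Space n × ℝ => b - q.2 := by fun_prop
    have hηκ : ContDiff ℝ ∞ fun r : Space n × ℝ => Real.smoothTransition (conePhase c a R r) :=
      hη.comp hκ
    -- The factor `b - t` removes the top of the slab, where the equation is not assumed; the smooth
    -- transition localizes to the cone.
    set ζ : Space n × ℝ → ℝ := fun r => (b - r.2) * Real.smoothTransition (conePhase c a R r)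
      with hζdef
    have hζ : ContDiff ℝ ∞ ζ := hl.mul hηκ
    have hζs : SpatiallyBounded a ζ := by
      -- For times after `a - 1` the phase is at most `R + c - ‖x‖`.
      refine ⟨R + c, fun r hr hra => ?_⟩
      have h2 : ‖r.1‖ ≤ √(1 + ‖r.1‖ ^ 2) := Real.le_sqrt_of_sq_le (by linarith)
      have h3 : conePhase c a R r ≤ 0 := by
        have : c * (r.2 - a) > c * (-1) := by gcongr; linarith
        simp only [conePhase]; linarith
      simp [hζdef, Real.smoothTransition.zero_of_nonpos h3]
    have hζT : ∀ r, dirDeriv (eT n) ζ r = -Real.smoothTransition (conePhase c a R r)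
        - (b - r.2) * deriv Real.smoothTransition (conePhase c a R r) * c := by
      intro r
      rw [hζdef, dirDeriv_mul hl hηκ, dirDeriv_comp (hη.differentiable (by simp)) hκ,
        dirDeriv_conePhase, dirDeriv_eT_sub]
      simp [eT]; ring
    have hζX : ∀ (i : Fin n) r, dirDeriv (eX i) ζ r
        = - ((b - r.2) * deriv Real.smoothTransition (conePhase c a R r))
          * (r.1 i / √(1 + ‖r.1‖ ^ 2)) := by
      intro i r
      rw [hζdef, dirDeriv_mul hl hηκ, dirDeriv_comp (hη.differentiable (by simp)) hκ,
        dirDeriv_conePhase, dirDeriv_eX_sub]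
      simp [eX, EuclideanSpace.inner_single_right]; ring
    set Q : Space n × ℝ → ℝ := fun p => - dirDeriv (eT n) ζ p * energy c w p
          + ∑ i, dirDeriv (eX i) ζ p * (dirDeriv (eT n) w p * dirDeriv (eX i) w p) with hQdef
    have hkey : ∫ p in univ ×ˢ Ioc a b, Q p = 0 := by
      rw [hQdef, ← energy_identity c hab.le hw hζ hζs (by simp [hζdef]) h0]
      refine (setIntegral_congr_fun (g := fun _ => (0 : ℝ))
        (MeasurableSet.univ.prod measurableSet_Ioc) fun r hr => ?_).trans (by simp)
      rcases hr.2.2.lt_or_eq with h | h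
      · simp [h1 r h]
      · simp [hζdef, h]
    have hen : ∀ r, 0 ≤ energy c w r := fun r => by unfold energy; positivity
    -- The derivative of the transition is nonnegative and multiplies the expression of
    -- `cone_cross_term`; dropping that term leaves the energy inside the cone.
    have hQge : ∀ r : Space n × ℝ, r.2 ≤ b →
        Real.smoothTransition (conePhase c a R r) * energy c w r ≤ Q r := by
      intro r hr
      have h3 := cone_cross_term (A := dirDeriv (eT n) w r) hc (fun i => r.1 i)
        (fun i => dirDeriv (eX i) w r) (s := √(1 + ‖r.1‖ ^ 2)) (by positivity)
        (by rw [Real.sq_sqrt (by positivity), EuclideanSpace.real_norm_sq_eq]; linarith)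
      have h4 : 0 ≤ (b - r.2) * deriv Real.smoothTransition (conePhase c a R r) :=
        mul_nonneg (by linarith) Real.smoothTransition.monotone.deriv_nonneg
      have h5 : Q r = Real.smoothTransition (conePhase c a R r) * energy c w r
          + (b - r.2) * deriv Real.smoothTransition (conePhase c a R r)
            * (c * energy c w r - ∑ i, r.1 i / √(1 + ‖r.1‖ ^ 2)
              * (dirDeriv (eT n) w r * dirDeriv (eX i) w r)) := by
        simp only [hQdef, hζT, hζX, mul_assoc, mul_sub, Finset.mul_sum, neg_mul,
          Finset.sum_neg_distrib]
        ring
      rw [h5]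
      have := mul_nonneg h4 h3
      simp only [energy] at this ⊢
      linarith
    have hst : ∀ r : Space n × ℝ, 0 ≤ Real.smoothTransition (conePhase c a R r) := fun r =>
      Real.smoothTransition.nonneg _
    have hQc : Continuous Q := by
      have hdζ := contDiff_dirDeriv hζ
      exact (((hdζ _).neg.mul (contDiff_energy c hw)).add
        (ContDiff.sum fun i _ => (hdζ _).mul ((hd _).mul (hd _)))).continuous
    have hQs : SpatiallyBounded a Q := by
      obtain ⟨R', hR'⟩ := hζs
      refine ⟨R', fun r hr hra => ?_⟩
      have : ∀ v, dirDeriv v ζ r = 0 := fun v => dirDeriv_eq_zero_of_eventuallyEq (by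
        filter_upwards [(isOpen_lt continuous_const (by fun_prop : Continuous fun q : Space n × ℝ =>
          ‖q.1‖)).mem_nhds hr, (isOpen_lt continuous_const continuous_snd).mem_nhds hra] with q h3 h4
        exact hR' q h3 h4) v
      simp [hQdef, this]
    have hae : Q =ᵐ[volume.restrict (univ ×ˢ Ioo a b)] 0 := by
      have h6 := (setIntegral_eq_zero_iff_of_nonneg_ae (μ := volume) (s := univ ×ˢ Ioc a b) (by
        filter_upwards [ae_restrict_mem (MeasurableSet.univ.prod measurableSet_Ioc)] with r hr
        exact (mul_nonneg (hst r) (hen r)).trans (hQge r hr.2.2)) (hQs.integrableOn hQc)).1 hkey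
      exact ae_restrict_of_ae_restrict_of_subset (prod_mono subset_rfl Ioo_subset_Ioc_self) h6
    -- `Q` is nonnegative with zero integral, hence zero almost everywhere, and by continuity
    -- everywhere on the open slab, in particular at `q`.
    have h7 := Measure.eqOn_open_of_ae_eq hae (isOpen_univ.prod isOpen_Ioo) hQc.continuousOn
      continuousOn_const (⟨mem_univ _, hq⟩ : q ∈ univ ×ˢ Ioo a b)
    have h8 := hQge q hq.2.le
    have h9 : 0 < Real.smoothTransition (conePhase c a R q) :=
      Real.smoothTransition.pos_of_pos (by simp only [conePhase, hRdef]; linarith)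
    rw [h7] at h8
    have h10 : energy c w q ≤ 0 := by
      by_contra h; exact absurd (mul_pos h9 (not_le.1 h)) (not_lt.2 h8)
    have h11 : 0 ≤ ∑ i, dirDeriv (eX i) w q ^ 2 := Finset.sum_nonneg fun i _ => sq_nonneg _
    have h12 : 1 / c ^ 2 * dirDeriv (eT n) w q ^ 2 ≤ 0 := by
      simp only [energy] at h10; linarith
    have h13 : dirDeriv (eT n) w q ^ 2 ≤ 0 := by
      by_contra h
      exact absurd (mul_pos (by positivity : 0 < 1 / c ^ 2) (not_le.1 h)) (not_lt.2 h12)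
    exact pow_eq_zero_iff (two_ne_zero) |>.1 (le_antisymm h13 (sq_nonneg _))
  rcases le_or_gt p.2 a with hpa | hpa
  · exact h0 p hpa
  have h2 := constant_of_has_deriv_right_zero (f := fun s => w (p.1, s)) (a := a) (b := p.2)
    (hw.continuous.comp (by fun_prop)).continuousOn (fun s hs => by
      have h3 : dirDeriv (eT n) w (p.1, s) = 0 := by
        rcases hs.1.eq_or_lt with h | h
        · exact dirDeriv_eq_zero_of_le hw h0 _ _ h.ge
        · exact hTz _ ⟨h, hs.2.trans hp⟩
      rw [← h3]
      exact (hasDerivAt_slice_snd hw p.1 s).hasDerivWithinAt) p.2 ⟨hpa.le, le_rfl⟩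
  exact h2.trans (h0 _ le_rfl)

end Estimates

/-! ### Uniqueness of weak solutions -/

section Uniqueness

open scoped Convolution

variable {n : ℕ}

/-- The mollification of `W` by `ρ`. -/
def mollify (ρ W : Space n × ℝ → ℝ) : Space n × ℝ → ℝ :=
  ρ ⋆[ContinuousLinearMap.lsmul ℝ ℝ, volume] W

lemma mollify_apply (ρ W : Space n × ℝ → ℝ) (p : Space n × ℝ) :
    mollify ρ W p = ∫ q, ρ (p - q) * W q := by
  rw [mollify, convolution_eq_swap]
  rfl

lemma contDiff_mollify {ρ W : Space n × ℝ → ℝ} (hρ : IsTest ρ) (hW : LocallyIntegrable W) :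
    ContDiff ℝ ∞ (mollify ρ W) :=
  hρ.2.contDiff_convolution_left _ hρ.1 hW

lemma integrable_mollify {ρ W : Space n × ℝ → ℝ} (hρ : IsTest ρ) (hW : LocallyIntegrable W)
    (p : Space n × ℝ) : Integrable fun q => ρ (p - q) * W q := by
  have := hρ.2.convolutionExists_left (ContinuousLinearMap.lsmul ℝ ℝ) hρ.1.continuous hW p
  rw [convolutionExistsAt_iff_integrable_swap] at this
  exact this

lemma dirDeriv_mollify {ρ W : Space n × ℝ → ℝ} (hρ : IsTest ρ) (hW : LocallyIntegrable W)
    (v : Space n × ℝ) : dirDeriv v (mollify ρ W) = mollify (dirDeriv v ρ) W := by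
  ext p
  have h1 := hρ.2.hasFDerivAt_convolution_left (μ := volume)
    (ContinuousLinearMap.lsmul ℝ ℝ) (hρ.1.of_le (by simp)) hW p
  have h2 := (hρ.2.fderiv (𝕜 := ℝ)).convolutionExists_left
    ((ContinuousLinearMap.lsmul ℝ ℝ).precompL (Space n × ℝ) :
      ((Space n × ℝ) →L[ℝ] ℝ) →L[ℝ] ℝ →L[ℝ] ((Space n × ℝ) →L[ℝ] ℝ))
    (hρ.1.continuous_fderiv (by simp)) hW p
  rw [dirDeriv, mollify, h1.fderiv, convolution_def, ContinuousLinearMap.integral_apply h2]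
  rfl

lemma waveOp_mollify (c : ℝ) {ρ W : Space n × ℝ → ℝ} (hρ : IsTest ρ) (hW : LocallyIntegrable W)
    (p : Space n × ℝ) : waveOp c (mollify ρ W) p = ∫ q, W q * waveOp c ρ (p - q) := by
  have h1 : ∀ v, dirDeriv v (dirDeriv v (mollify ρ W)) p
      = ∫ q, dirDeriv v (dirDeriv v ρ) (p - q) * W q := fun v => by
    rw [dirDeriv_mollify hρ hW, dirDeriv_mollify (isTest_dirDeriv hρ v) hW, mollify_apply]
  have h2 := fun v => integrable_mollify (isTest_dirDeriv (isTest_dirDeriv hρ v) v) hW p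
  rw [waveOp_eq c (contDiff_mollify hρ hW)]
  simp_rw [h1]
  rw [← integral_const_mul, ← integral_finsetSum _ fun i _ => h2 (eX i),
    ← integral_sub ((h2 _).const_mul _) (integrable_finsetSum _ fun i _ => h2 (eX i))]
  refine integral_congr_ae (Eventually.of_forall fun q => ?_)
  dsimp only
  rw [waveOp_eq c hρ.1, mul_sub, Finset.mul_sum, mul_comm (W q)]
  congr 1
  · ring
  · exact Finset.sum_congr rfl fun i _ => mul_comm _ _

lemma dirDeriv_comp_sub {ρ : Space n × ℝ → ℝ} (hρ : ContDiff ℝ ∞ ρ) (p v : Space n × ℝ) :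
    dirDeriv v (fun q => ρ (p - q)) = fun q => - dirDeriv v ρ (p - q) := by
  ext q
  have h1 : HasFDerivAt (fun q => ρ (p - q)) _ q :=
    ((hρ.differentiable (by simp) (p - q)).hasFDerivAt).comp q ((hasFDerivAt_id q).const_sub p)
  simp [dirDeriv, h1.fderiv]

lemma contDiff_comp_sub {ρ : Space n × ℝ → ℝ} (hρ : ContDiff ℝ ∞ ρ) (p : Space n × ℝ) :
    ContDiff ℝ ∞ fun q => ρ (p - q) :=
  hρ.comp (contDiff_const.sub contDiff_id)

/-- The reflection produces two signs, which cancel in second derivatives. So □ of a mollification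
is the weak formulation tested with a reflected and translated kernel. -/
lemma waveOp_comp_sub (c : ℝ) {ρ : Space n × ℝ → ℝ} (hρ : ContDiff ℝ ∞ ρ) (p q : Space n × ℝ) :
    waveOp c (fun q => ρ (p - q)) q = waveOp c ρ (p - q) := by
  have h : ∀ v, dirDeriv v (dirDeriv v fun q => ρ (p - q)) q
      = dirDeriv v (dirDeriv v ρ) (p - q) := fun v => by
    rw [dirDeriv_comp_sub hρ]
    have : (fun q => - dirDeriv v ρ (p - q)) = -fun q => dirDeriv v ρ (p - q) := rfl
    have h3 := congrFun (dirDeriv_comp_sub (contDiff_dirDeriv hρ v) p v) q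
    rw [this, dirDeriv, fderiv_neg]
    simp only [dirDeriv] at h3 ⊢
    simp [h3]
  rw [waveOp_eq c (contDiff_comp_sub hρ p), waveOp_eq c hρ]
  simp_rw [h]

/-- Very weak solutions of the homogeneous wave equation with zero past vanish. -/
lemma ae_eq_zero_of_weak_forward {c T : ℝ} (hc : 0 < c) {W : Space n × ℝ → ℝ}
    (hW : LocallyIntegrable W) (h0 : ∀ p : Space n × ℝ, p.2 ≤ 0 → W p = 0)
    (h : ∀ φ : Space n × ℝ → ℝ, IsTest φ → tsupport φ ⊆ univ ×ˢ Iio T →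
      ∫ p, W p * waveOp c φ p = 0) :
    ∀ᵐ p : Space n × ℝ, p.2 < T → W p = 0 := by
  let φ : ℕ → ContDiffBump (0 : Space n × ℝ) := fun k =>
    ⟨1 / ((k : ℝ) + 1) / 2, 1 / ((k : ℝ) + 1), by positivity, half_lt_self (by positivity)⟩
  have hlim : Tendsto (fun k => (φ k).rOut) atTop (𝓝 0) := tendsto_one_div_add_atTop_nhds_zero_nat
  -- Almost everywhere convergence of the mollifications needs the ratio of outer to inner radius to
  -- stay bounded; here it is 2.
  have hconv := ContDiffBump.ae_convolution_tendsto_right_of_locallyIntegrable (μ := volume)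
    (K := 2) hlim (Eventually.of_forall fun k => by dsimp only [φ]; linarith) hW
  filter_upwards [hconv] with p hp hpT
  have hz : ∀ k, p.2 < T - (φ k).rOut → mollify ((φ k).normed volume) W p = 0 := by
    intro k hk
    have hρ : IsTest ((φ k).normed volume) :=
      ⟨(φ k).contDiff_normed, (φ k).hasCompactSupport_normed⟩
    -- A kernel of radius `rOut` blurs time by at most `rOut`: the mollification vanishes before
    -- `-rOut` and solves the equation before `T - rOut`.
    refine eq_zero_of_waveOp_eq_zero hc (contDiff_mollify hρ hW) (a := - (φ k).rOut)
      (fun q hq => ?_) (fun q hq => ?_) p hk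
    · rw [mollify_apply]
      refine (integral_congr_ae (Eventually.of_forall fun r => ?_)).trans (integral_zero _ _)
      rcases le_or_gt r.2 0 with hr | hr
      · simp [h0 r hr]
      · have : q - r ∉ Function.support ((φ k).normed volume) := by
          rw [ContDiffBump.support_normed_eq, mem_ball_zero_iff, not_lt]
          refine le_trans ?_ (norm_snd_le _)
          rw [Real.norm_eq_abs, Prod.snd_sub]
          refine le_trans ?_ (neg_le_abs _)
          linarith
        rw [Function.notMem_support.1 this, zero_mul]
    · rw [waveOp_mollify c hρ hW, ← h (fun r => (φ k).normed volume (q - r))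
        ⟨contDiff_comp_sub hρ.1 q, ?_⟩ ?_]
      · exact integral_congr_ae (Eventually.of_forall fun r => by
          dsimp only; rw [waveOp_comp_sub c hρ.1])
      · exact hρ.2.comp_homeomorph (Homeomorph.subLeft q)
      · have hcl : IsClosed {r : Space n × ℝ | r.2 ≤ q.2 + (φ k).rOut} :=
          isClosed_le continuous_snd continuous_const
        refine (closure_minimal (fun r hr => ?_) hcl).trans (fun r hr => ?_)
        · have hr' : q - r ∈ Function.support ((φ k).normed volume) := hr
          rw [ContDiffBump.support_normed_eq, mem_ball_zero_iff] at hr'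
          have h2 := (norm_snd_le (q - r)).trans hr'.le
          rw [Real.norm_eq_abs, Prod.snd_sub, abs_le] at h2
          simp only [mem_ofPred_eq]; linarith
        · simp only [mem_ofPred_eq] at hr
          exact ⟨mem_univ _, by simp only [mem_Iio]; linarith⟩
  have hev : ∀ᶠ k in atTop, mollify ((φ k).normed volume) W p = 0 := by
    filter_upwards [hlim.eventually_lt_const (by linarith : 0 < T - p.2)] with k hk
    exact hz k (by linarith)
  exact tendsto_nhds_unique hp (tendsto_const_nhds.congr' (hev.mono fun k hk => hk.symm))

/-! ### Time reversal -/

/-- Reflection in time. -/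
def timeReflect (T : ℝ) (p : Space n × ℝ) : Space n × ℝ := (p.1, T - p.2)

lemma measurePreserving_timeReflect (T : ℝ) :
    MeasurePreserving (timeReflect (n := n) T) volume volume :=
  (MeasurePreserving.id volume).prod (Measure.measurePreserving_sub_left volume T)

lemma timeReflect_timeReflect (T : ℝ) (p : Space n × ℝ) :
    timeReflect T (timeReflect T p) = p := by
  simp [timeReflect]

lemma continuous_timeReflect (T : ℝ) : Continuous (timeReflect (n := n) T) := by
  unfold timeReflect; fun_prop

/-- Reflection in time as a homeomorphism. -/
def timeReflectHomeo (T : ℝ) : Space n × ℝ ≃ₜ Space n × ℝ where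
  toFun := timeReflect T
  invFun := timeReflect T
  left_inv := timeReflect_timeReflect T
  right_inv := timeReflect_timeReflect T
  continuous_toFun := continuous_timeReflect T
  continuous_invFun := continuous_timeReflect T

lemma waveOp_timeReflect (c T : ℝ) (φ : Space n × ℝ → ℝ) (p : Space n × ℝ) :
    waveOp c (fun q => φ (timeReflect T q)) p = waveOp c φ (timeReflect T p) := by
  simp only [waveOp, timeReflect]
  congr 2
  have := congrFun (iteratedDeriv_comp_const_sub 2 (fun t => φ (p.1, t)) T) p.2
  simpa using this

lemma integral_timeReflect (T : ℝ) (F : Space n × ℝ → ℝ) :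
    ∫ p, F (timeReflect T p) = ∫ p, F p :=
  (measurePreserving_timeReflect T).integral_comp
    (timeReflectHomeo (n := n) T).measurableEmbedding F

/-- The reflection `t ↦ T - t` preserves Lebesgue measure and □ and exchanges the two classes of
test functions, which reduces this to the forward case. -/
lemma ae_eq_zero_of_weak_backward {c T : ℝ} (hc : 0 < c) {W : Space n × ℝ → ℝ}
    (hW : LocallyIntegrable W) (h0 : ∀ p : Space n × ℝ, T ≤ p.2 → W p = 0)
    (h : ∀ φ : Space n × ℝ → ℝ, IsTest φ → tsupport φ ⊆ univ ×ˢ Ioi 0 →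
      ∫ p, W p * waveOp c φ p = 0) :
    ∀ᵐ p : Space n × ℝ, 0 < p.2 → W p = 0 := by
  have hmp := measurePreserving_timeReflect (n := n) T
  have hW' : LocallyIntegrable fun p => W (timeReflect T p) := by
    intro p
    obtain ⟨s, hs, hi⟩ := hW (timeReflect T p)
    refine ⟨timeReflect T ⁻¹' s, (continuous_timeReflect T).continuousAt.preimage_mem_nhds hs, ?_⟩
    exact (hmp.integrableOn_comp_preimage (timeReflectHomeo (n := n) T).measurableEmbedding).2 hi
  have key := ae_eq_zero_of_weak_forward (T := T) hc hW'
    (fun p hp => h0 _ (by simp only [timeReflect]; linarith)) fun φ hφ hsupp => ?_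
  · filter_upwards [hmp.quasiMeasurePreserving.ae key] with p hp hp0
    rw [timeReflect_timeReflect] at hp
    exact hp (by simp only [timeReflect]; linarith)
  · rw [← integral_timeReflect T]
    simp_rw [timeReflect_timeReflect, ← waveOp_timeReflect c T φ]
    refine h _ ⟨hφ.1.comp ?_, hφ.2.comp_homeomorph (timeReflectHomeo T)⟩ fun p hp => ?_
    · exact contDiff_fst.prodMk (contDiff_const.sub contDiff_snd)
    · have h1 : timeReflect T p ∈ tsupport φ :=
        tsupport_comp_subset_preimage φ (continuous_timeReflect T) hp
      have h2 := (hsupp h1).2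
      simp only [timeReflect, mem_Iio] at h2
      exact ⟨mem_univ _, by simp only [mem_Ioi]; linarith⟩

/-- The slice `t = T` is null. On the open slab the extension by zero vanishes at both end times,
and the fundamental lemma of the calculus of variations applies. -/
lemma slab_eq_restrict_Ioo (n : ℕ) (T : ℝ) :
    slab n T = (volume : Measure (Space n × ℝ)).restrict (univ ×ˢ Ioo 0 T) := by
  rw [slab, Measure.volume_eq_prod, ← Measure.prod_restrict, ← Measure.prod_restrict,
    restrict_Ioo_eq_restrict_Ioc]

lemma locallyIntegrable_indicator_slab {T : ℝ} {W : Space n × ℝ → ℝ} (hW : MemLp W 2 (slab n T)) :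
    LocallyIntegrable ((univ ×ˢ Ioo 0 T).indicator W) := by
  rw [slab_eq_restrict_Ioo] at hW
  exact ((memLp_indicator_iff_restrict (MeasurableSet.univ.prod measurableSet_Ioo)).2 hW)
    |>.locallyIntegrable one_le_two

lemma integral_slab_eq_indicator (T : ℝ) (W F : Space n × ℝ → ℝ) :
    ∫ p, W p * F p ∂slab n T = ∫ p, (univ ×ˢ Ioo 0 T).indicator W p * F p := by
  rw [slab_eq_restrict_Ioo, ← integral_indicator (MeasurableSet.univ.prod measurableSet_Ioo)]
  simp_rw [indicator_mul_left]

lemma ae_slab_eq_zero_iff {T : ℝ} {F : Type*} [Zero F] {W : Space n × ℝ → F} :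
    W =ᵐ[slab n T] 0 ↔ ∀ᵐ p : Space n × ℝ, p ∈ univ ×ˢ Ioo 0 T → W p = 0 := by
  rw [slab_eq_restrict_Ioo, EventuallyEq,
    ae_restrict_iff' (MeasurableSet.univ.prod measurableSet_Ioo)]
  rfl

lemma slab_forward_unique {c T : ℝ} (hc : 0 < c) {W : Space n × ℝ → ℝ} (hW : MemLp W 2 (slab n T))
    (h : ∀ φ : Space n × ℝ → ℝ, IsTest φ → tsupport φ ⊆ univ ×ˢ Iio T →
      ∫ p, W p * waveOp c φ p ∂slab n T = 0) : W =ᵐ[slab n T] 0 := by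
  have := ae_eq_zero_of_weak_forward (T := T) hc (locallyIntegrable_indicator_slab hW)
    (fun p hp => indicator_of_notMem (fun h => not_lt.2 hp h.2.1) _)
    fun φ hφ hs => by rw [← integral_slab_eq_indicator]; exact h φ hφ hs
  rw [ae_slab_eq_zero_iff]
  filter_upwards [this] with p hp hpm
  simpa [indicator_of_mem hpm] using hp hpm.2.2

lemma slab_backward_unique {c T : ℝ} (hc : 0 < c) {W : Space n × ℝ → ℝ}
    (hW : MemLp W 2 (slab n T))
    (h : ∀ φ : Space n × ℝ → ℝ, IsTest φ → tsupport φ ⊆ univ ×ˢ Ioi 0 →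
      ∫ p, W p * waveOp c φ p ∂slab n T = 0) : W =ᵐ[slab n T] 0 := by
  have := ae_eq_zero_of_weak_backward (T := T) hc (locallyIntegrable_indicator_slab hW)
    (fun p hp => indicator_of_notMem (fun h => not_lt.2 hp h.2.2) _)
    fun φ hφ hs => by rw [← integral_slab_eq_indicator]; exact h φ hφ hs
  rw [ae_slab_eq_zero_iff]
  filter_upwards [this] with p hp hpm
  simpa [indicator_of_mem hpm] using hp hpm.2.1

lemma weakGradX_unique {T : ℝ} {U : L2Slab n T} {G G' : Space n × ℝ → Space n}
    (hG : IsWeakGradX T U G) (hG' : IsWeakGradX T U G') : G =ᵐ[slab n T] G' := by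
  have hL : MemLp (G - G') 2 (slab n T) := hG.1.sub hG'.1
  have hmeas : MeasurableSet (univ ×ˢ Ioo 0 T : Set (Space n × ℝ)) :=
    MeasurableSet.univ.prod measurableSet_Ioo
  have hloc : LocallyIntegrable ((univ ×ˢ Ioo 0 T).indicator (G - G')) := by
    rw [slab_eq_restrict_Ioo] at hL
    exact ((memLp_indicator_iff_restrict hmeas).2 hL).locallyIntegrable one_le_two
  have key := (isOpen_univ.prod (isOpen_Ioo (a := (0 : ℝ)) (b := T)))
    |>.ae_eq_zero_of_integral_contDiff_smul_eq_zero (μ := volume)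
      (hloc.locallyIntegrableOn (univ ×ˢ Ioo 0 T)) fun φ hφ hcs hs => ?_
  · have h0 : (G - G') =ᵐ[slab n T] 0 := by
      rw [ae_slab_eq_zero_iff]
      filter_upwards [key] with p hp hpm
      simpa [indicator_of_mem hpm] using hp hpm
    filter_upwards [h0] with p hp
    exact sub_eq_zero.1 hp
  · have h1 := hG.2 φ ⟨hφ, hcs⟩ hs
    have h2 := hG'.2 φ ⟨hφ, hcs⟩ hs
    rw [h1] at h2
    have hφ2 : MemLp φ 2 (slab n T) :=
      (hφ.continuous.memLp_of_hasCompactSupport hcs).restrict _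
    have hi : ∀ G'' : Space n × ℝ → Space n, MemLp G'' 2 (slab n T) →
        Integrable (fun p => φ p • G'' p) (slab n T) := fun G'' h =>
      memLp_one_iff_integrable.1 (h.smul (r := 1) hφ2)
    have h3 : ∫ p, φ p • (G - G') p ∂slab n T = 0 := by
      simp only [Pi.sub_apply, smul_sub]
      rw [integral_sub (hi G hG.1) (hi G' hG'.1), neg_injective h2, sub_self]
    rw [slab_eq_restrict_Ioo, ← integral_indicator hmeas] at h3
    rw [← h3]
    exact integral_congr_ae (Eventually.of_forall fun p => (indicator_smul_apply _ _ _ _).symm)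

end Uniqueness

/-! ### The trace inequality on Lipschitz boundaries -/

section Trace

/-- The Euclidean normalization is the same factor in both spaces, so the Lipschitz bound for
Hausdorff measure carries over. -/
lemma euclideanHausdorffMeasure_image_le {X Y : Type*} [EMetricSpace X] [MeasurableSpace X]
    [BorelSpace X] [EMetricSpace Y] [MeasurableSpace Y] [BorelSpace Y] {K : ℝ≥0} {f : X → Y}
    (hf : LipschitzWith K f) (d : ℕ) (s : Set X) :
    (μHE[d] : Measure Y) (f '' s) ≤ (K : ℝ≥0∞) ^ d * (μHE[d] : Measure X) s := by
  simp only [Measure.euclideanHausdorffMeasure_def, Measure.smul_apply]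
  have h := hf.hausdorffMeasure_image_le (d := d) (by positivity) s
  rw [ENNReal.rpow_natCast] at h
  rw [mul_smul_comm]
  exact smul_le_smul_of_nonneg_left h zero_le

/-- Integrate `(ψ²)' = 2ψψ' ≤ ψ² + ψ'²` from `-∞` to `t`. -/
lemma sq_le_integral_line {ψ : ℝ → ℝ} (hψ : ContDiff ℝ 1 ψ) (hs : HasCompactSupport ψ) (t : ℝ) :
    ‖ψ t‖ₑ ^ 2 ≤ ∫⁻ s, (‖ψ s‖ₑ ^ 2 + ‖deriv ψ s‖ₑ ^ 2) := by
  have hd : Continuous (deriv ψ) := hψ.continuous_deriv (by simp)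
  have hds : HasCompactSupport (deriv ψ) := hs.deriv
  have h1 := (hs.mul_left (f := ψ)).integral_Iic_deriv_eq (hψ.mul hψ) t
  have h2 : deriv (fun x => ψ x * ψ x) = fun s => 2 * ψ s * deriv ψ s := by
    ext s
    have h := hψ.differentiable (by simp) s
    rw [deriv_fun_mul h h]; ring
  have hi : Integrable fun s => ψ s ^ 2 + deriv ψ s ^ 2 := by
    refine Integrable.add ?_ ?_
    · exact (hψ.continuous.pow 2).integrable_of_hasCompactSupport (by
        simpa [sq] using hs.mul_left (f := ψ))
    · exact (hd.pow 2).integrable_of_hasCompactSupport (by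
        simpa [sq] using hds.mul_left (f := deriv ψ))
  have h3 : ψ t ^ 2 ≤ ∫ s, (ψ s ^ 2 + deriv ψ s ^ 2) := by
    rw [h2] at h1
    calc ψ t ^ 2 = ∫ s in Iic t, 2 * ψ s * deriv ψ s := by rw [h1]; simp [sq]
      _ ≤ ∫ s in Iic t, (ψ s ^ 2 + deriv ψ s ^ 2) := by
        refine integral_mono ?_ hi.integrableOn fun s => two_mul_le_add_sq _ _
        exact (((continuous_const.mul hψ.continuous).mul hd).integrable_of_hasCompactSupport
          hds.mul_left).integrableOn
      _ ≤ _ := setIntegral_le_integral hi (Eventually.of_forall fun s => by positivity)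
  have he : ∀ r : ℝ, ‖r‖ₑ ^ 2 = ENNReal.ofReal (r ^ 2) := fun r => by
    rw [← ofReal_norm, ← ENNReal.ofReal_pow (norm_nonneg _), Real.norm_eq_abs, sq_abs]
  simp_rw [he, ← ENNReal.ofReal_add (sq_nonneg _) (sq_nonneg _)]
  rw [← ofReal_integral_eq_lintegral_ofReal hi (Eventually.of_forall fun s => by positivity)]
  exact ENNReal.ofReal_le_ofReal h3

variable {n : ℕ}

/-- Decomposition of `x` into its components orthogonal and parallel to the unit vector `e`. -/
def splitAlong (e : Space n) (he : ‖e‖ = 1) : ((ℝ ∙ e)ᗮ × ℝ) ≃L[ℝ] Space n :=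
  LinearEquiv.toContinuousLinearEquiv
    { toFun := fun q => (q.1 : Space n) + q.2 • e
      invFun := fun x => ((ℝ ∙ e)ᗮ.orthogonalProjectionOnto x, inner ℝ e x)
      map_add' := fun p q => by simp [add_smul]; abel
      map_smul' := fun r q => by simp [mul_smul]
      left_inv := fun q => by
        have h1 : inner ℝ e (q.1 : Space n) = 0 :=
          Submodule.mem_orthogonal_singleton_iff_inner_right.1 q.1.2
        have h2 : (ℝ ∙ e)ᗮ.orthogonalProjectionOnto e = 0 :=
          Submodule.orthogonalProjectionOnto_orthogonalComplement_singleton_eq_zero e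
        simp [inner_add_right, inner_smul_right, h1, h2, he]
      right_inv := fun x => by
        have h := Submodule.starProjection_add_starProjection_orthogonal (K := ℝ ∙ e) x
        rw [Submodule.starProjection_unit_singleton ℝ he] at h
        exact (add_comm _ _).trans h }

lemma splitAlong_proj (e : Space n) (he : ‖e‖ = 1) (x : Space n) :
    ((ℝ ∙ e)ᗮ.orthogonalProjectionOnto x : Space n) + (inner ℝ e x : ℝ) • e = x :=
  (splitAlong e he).apply_symm_apply x

lemma isAddHaarMeasure_hyperplane (e : Space n) (he : ‖e‖ = 1) :
    (μHE[n - 1] : Measure (ℝ ∙ e)ᗮ).IsAddHaarMeasure := by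
  have hne : e ≠ 0 := fun h => by simp [h] at he
  have h : Module.finrank ℝ (ℝ ∙ e)ᗮ = n - 1 := by
    have h1 := Submodule.finrank_add_finrank_orthogonal (ℝ ∙ e)
    rw [finrank_span_singleton hne, finrank_euclideanSpace_fin] at h1
    omega
  rw [← h]
  infer_instance

/-- Tonelli along `e`: the product measure pushed to `ℝⁿ` is a Haar measure, hence a multiple of
Lebesgue measure. The value of the factor is not needed. -/
lemma exists_lintegral_hyperplane_eq (e : Space n) (he : ‖e‖ = 1) : ∃ k : ℝ≥0,
    ∀ F : Space n → ℝ≥0∞, Measurable F →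
      ∫⁻ y : (ℝ ∙ e)ᗮ, (∫⁻ s : ℝ, F ((y : Space n) + s • e)) ∂μHE[n - 1] = k * ∫⁻ x, F x := by
  have := isAddHaarMeasure_hyperplane e he
  set ν : Measure (ℝ ∙ e)ᗮ := μHE[n - 1]
  have h1 : (Measure.map (splitAlong e he) (ν.prod volume)).IsAddHaarMeasure :=
    (splitAlong e he).isAddHaarMeasure_map _
  have h2 := Measure.isAddLeftInvariant_eq_smul
    (Measure.map (splitAlong e he) (ν.prod volume)) (volume : Measure (Space n))
  refine ⟨Measure.addHaarScalarFactor (Measure.map (splitAlong e he) (ν.prod volume)) volume,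
    fun F hF => ?_⟩
  have hm : Measurable (splitAlong e he) := (splitAlong e he).continuous.measurable
  rw [← smul_eq_mul, ← ENNReal.smul_def, ← lintegral_smul_measure, ← h2, lintegral_map hF hm,
    lintegral_prod (fun a => F (splitAlong e he a)) (hF.comp hm).aemeasurable]
  rfl

/-- The graph of `γ` over the hyperplane orthogonal to `e`. -/
def graphMap (e : Space n) (γ : (ℝ ∙ e)ᗮ → ℝ) (y : (ℝ ∙ e)ᗮ) : Space n := (y : Space n) + γ y • e

lemma lipschitzWith_graphMap {e : Space n} (he : ‖e‖ = 1) {γ : (ℝ ∙ e)ᗮ → ℝ} {K : ℝ≥0}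
    (hγ : LipschitzWith K γ) : LipschitzWith (1 + K) (graphMap e γ) := by
  refine LipschitzWith.add (LipschitzWith.subtype_val _) ?_
  refine LipschitzWith.of_dist_le_mul fun x y => ?_
  rw [dist_eq_norm, ← sub_smul, norm_smul, he, mul_one, ← dist_eq_norm]
  exact hγ.dist_le_mul x y

/-- The graph is a Lipschitz image of the hyperplane. This upper bound on surface measure replaces
the area formula. -/
lemma restrict_graph_le {e : Space n} (he : ‖e‖ = 1) {γ : (ℝ ∙ e)ᗮ → ℝ} {K : ℝ≥0}
    (hγ : LipschitzWith K γ) :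
    (μHE[n - 1] : Measure (Space n)).restrict (range (graphMap e γ))
      ≤ ((1 + K : ℝ≥0) : ℝ≥0∞) ^ (n - 1) • Measure.map (graphMap e γ) μHE[n - 1] := by
  have hL := lipschitzWith_graphMap he hγ
  refine Measure.le_iff.2 fun s hs => ?_
  rw [Measure.restrict_apply hs, Measure.smul_apply, Measure.map_apply hL.continuous.measurable hs,
    ← image_preimage_eq_inter_range]
  exact euclideanHausdorffMeasure_image_le hL _ _

/-- Each value on the graph is bounded by an integral over the full line in direction `e`;
integrating over the hyperplane gives the integral over `ℝⁿ`. As `ψ` lives on all of `ℝⁿ`, no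
extension from `Ω` is involved. -/
lemma lintegral_graph_le {e : Space n} (he : ‖e‖ = 1) {γ : (ℝ ∙ e)ᗮ → ℝ} {K : ℝ≥0}
    (hγ : LipschitzWith K γ) : ∃ C : ℝ≥0, ∀ ψ : Space n → ℝ, ContDiff ℝ 1 ψ → HasCompactSupport ψ →
      ∫⁻ x in range (graphMap e γ), ‖ψ x‖ₑ ^ 2 ∂μHE[n - 1]
        ≤ C * ∫⁻ x, (‖ψ x‖ₑ ^ 2 + ‖fderiv ℝ ψ x‖ₑ ^ 2) := by
  obtain ⟨k, hk⟩ := exists_lintegral_hyperplane_eq e he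
  refine ⟨(1 + K) ^ (n - 1) * k, fun ψ hψ hs => ?_⟩
  have hL := (lipschitzWith_graphMap he hγ).continuous
  have hψm : Measurable fun x => ‖ψ x‖ₑ ^ 2 := by
    have := hψ.continuous.measurable
    fun_prop
  have hFm : Measurable fun x => (‖ψ x‖ₑ ^ 2 + ‖fderiv ℝ ψ x‖ₑ ^ 2) := by
    have := (hψ.continuous_fderiv (by simp)).measurable
    exact hψm.add (this.enorm.pow_const 2)
  have hline : ∀ y : (ℝ ∙ e)ᗮ, ‖ψ (graphMap e γ y)‖ₑ ^ 2
      ≤ ∫⁻ s : ℝ, (‖ψ ((y : Space n) + s • e)‖ₑ ^ 2 + ‖fderiv ℝ ψ ((y : Space n) + s • e)‖ₑ ^ 2) := by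
    intro y
    have hl : ContDiff ℝ 1 fun s : ℝ => (y : Space n) + s • e := by fun_prop
    have hce : IsClosedEmbedding fun s : ℝ => (y : Space n) + s • e := by
      refine Isometry.isClosedEmbedding (Isometry.of_dist_eq fun s t => ?_)
      rw [dist_add_left, dist_eq_norm, ← sub_smul, norm_smul, he, mul_one, ← dist_eq_norm]
    refine (sq_le_integral_line (hψ.comp hl) (hs.comp_isClosedEmbedding hce) (γ y)).trans
      (lintegral_mono fun s => ?_)
    have hd : HasDerivAt (fun s : ℝ => (y : Space n) + s • e) e s := by
      simpa using ((hasDerivAt_id s).smul_const e).const_add (y : Space n)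
    have h1 := ((hψ.differentiable (by simp) ((y : Space n) + s • e)).hasFDerivAt).comp_hasDerivAt
      s hd
    rw [h1.deriv]
    simp only [Function.comp]
    gcongr
    rw [← ofReal_norm, ← ofReal_norm]
    refine ENNReal.ofReal_le_ofReal ?_
    simpa [he] using (fderiv ℝ ψ ((y : Space n) + s • e)).le_opNorm e
  calc _ ≤ ∫⁻ x, ‖ψ x‖ₑ ^ 2
          ∂(((1 + K : ℝ≥0) : ℝ≥0∞) ^ (n - 1) • Measure.map (graphMap e γ) μHE[n - 1]) :=
        lintegral_mono' (restrict_graph_le he hγ) le_rfl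
    _ = ((1 + K : ℝ≥0) : ℝ≥0∞) ^ (n - 1) * ∫⁻ y, ‖ψ (graphMap e γ y)‖ₑ ^ 2 ∂μHE[n - 1] := by
        rw [lintegral_smul_measure, lintegral_map hψm hL.measurable, smul_eq_mul]
    _ ≤ ((1 + K : ℝ≥0) : ℝ≥0∞) ^ (n - 1) * (k * ∫⁻ x, (‖ψ x‖ₑ ^ 2 + ‖fderiv ℝ ψ x‖ₑ ^ 2)) := by
        rw [← hk _ hFm]
        gcongr
        exact hline _
    _ = _ := by push_cast; ring

/-- Orthogonal projection is a contraction, so this piece of graph is a Lipschitz image of a bounded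
set of the hyperplane. -/
lemma graph_inter_ball_lt_top {e : Space n} (he : ‖e‖ = 1) {γ : (ℝ ∙ e)ᗮ → ℝ} {K : ℝ≥0}
    (hγ : LipschitzWith K γ) (p : Space n) (r : ℝ) :
    (μHE[n - 1] : Measure (Space n)) (range (graphMap e γ) ∩ Metric.ball p r) < ⊤ := by
  have := isAddHaarMeasure_hyperplane e he
  have hb : Bornology.IsBounded (graphMap e γ ⁻¹' Metric.ball p r) := by
    refine (Metric.isBounded_ball (x := (0 : (ℝ ∙ e)ᗮ)) (r := r + ‖p‖)).subset fun y hy => ?_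
    have h1 : (ℝ ∙ e)ᗮ.orthogonalProjectionOnto (graphMap e γ y) = y :=
      congrArg Prod.fst ((splitAlong e he).symm_apply_apply (y, γ y))
    have h2 : ‖y‖ ≤ ‖graphMap e γ y‖ := by
      conv_lhs => rw [← h1]
      exact Submodule.norm_orthogonalProjectionOnto_apply_le _ _
    rw [mem_ball_zero_iff]
    have h3 : ‖graphMap e γ y - p‖ < r := by simpa [dist_eq_norm] using hy
    have h4 := norm_le_norm_sub_add (graphMap e γ y) p
    linarith
  rw [inter_comm, ← image_preimage_eq_inter_range]
  refine (euclideanHausdorffMeasure_image_le (lipschitzWith_graphMap he hγ) _ _).trans_lt ?_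
  exact ENNReal.mul_lt_top (by finiteness) hb.measure_lt_top

/-- A boundary point is not in the open set `Ω`, so it is not above the graph; were it strictly
below, a neighbourhood would miss `Ω`. -/
lemma frontier_inter_ball_subset {Ω : Set (Space n)} (hΩ : IsOpen Ω) {e : Space n} (he : ‖e‖ = 1)
    {γ : (ℝ ∙ e)ᗮ → ℝ} (hγ : Continuous γ) {p : Space n} {r : ℝ}
    (h : ∀ x ∈ Metric.ball p r,
      (x ∈ Ω ↔ γ ((ℝ ∙ e)ᗮ.orthogonalProjectionOnto x) < inner ℝ e x)) :
    frontier Ω ∩ Metric.ball p r ⊆ range (graphMap e γ) := by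
  rintro x ⟨hx, hxb⟩
  have hxΩ : x ∉ Ω := fun h => (hΩ.frontier_eq ▸ hx).2 h
  have h1 : inner ℝ e x ≤ γ ((ℝ ∙ e)ᗮ.orthogonalProjectionOnto x) :=
    not_lt.1 fun hlt => hxΩ ((h x hxb).2 hlt)
  have h2 : γ ((ℝ ∙ e)ᗮ.orthogonalProjectionOnto x) ≤ inner ℝ e x := by
    by_contra hlt
    have ho : IsOpen {z : Space n | inner ℝ e z < γ ((ℝ ∙ e)ᗮ.orthogonalProjectionOnto z)} :=
      isOpen_lt (by fun_prop) (hγ.comp (ContinuousLinearMap.continuous _))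
    obtain ⟨z, hz, hzΩ⟩ := mem_closure_iff.1 (frontier_subset_closure hx) _
      (ho.inter Metric.isOpen_ball) ⟨not_le.1 hlt, hxb⟩
    exact absurd ((h z hz.2).1 hzΩ) (not_lt.2 (le_of_lt hz.1))
  refine ⟨(ℝ ∙ e)ᗮ.orthogonalProjectionOnto x, ?_⟩
  rw [graphMap, le_antisymm h2 h1, splitAlong_proj e he]

/-- The trace inequality. -/
lemma exists_trace_inequality {Ω : Set (Space n)} (hΩo : IsOpen Ω) (hΩb : Bornology.IsBounded Ω)
    (hΩl : HasLipschitzBoundary Ω) :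
    (μHE[n - 1] : Measure (Space n)) (frontier Ω) < ⊤ ∧
    ∃ C : ℝ≥0, ∀ ψ : Space n → ℝ, ContDiff ℝ 1 ψ → HasCompactSupport ψ →
      ∫⁻ x in frontier Ω, ‖ψ x‖ₑ ^ 2 ∂μHE[n - 1]
        ≤ C * ∫⁻ x, (‖ψ x‖ₑ ^ 2 + ‖fderiv ℝ ψ x‖ₑ ^ 2) := by
  have hcpt : IsCompact (frontier Ω) :=
    hΩb.isCompact_closure.of_isClosed_subset isClosed_frontier frontier_subset_closure
  -- The claim passes to subsets and finite unions, so by compactness a single graph chart suffices.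
  refine hcpt.induction_on (p := fun S => (μHE[n - 1] : Measure (Space n)) S < ⊤ ∧
    ∃ C : ℝ≥0, ∀ ψ : Space n → ℝ, ContDiff ℝ 1 ψ → HasCompactSupport ψ →
      ∫⁻ x in S, ‖ψ x‖ₑ ^ 2 ∂μHE[n - 1]
        ≤ C * ∫⁻ x, (‖ψ x‖ₑ ^ 2 + ‖fderiv ℝ ψ x‖ₑ ^ 2)) ?_ ?_ ?_ ?_
  · exact ⟨by simp, 0, fun ψ _ _ => by simp⟩
  · rintro s t hst ⟨h1, C, hC⟩
    exact ⟨(measure_mono hst).trans_lt h1, C, fun ψ h2 h3 =>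
      (lintegral_mono_set hst).trans (hC ψ h2 h3)⟩
  · rintro s t ⟨h1, C, hC⟩ ⟨h2, C', hC'⟩
    refine ⟨(measure_union_le _ _).trans_lt (ENNReal.add_lt_top.2 ⟨h1, h2⟩), C + C',
      fun ψ h3 h4 => (lintegral_union_le _ _ _).trans ?_⟩
    push_cast
    rw [add_mul]
    exact add_le_add (hC ψ h3 h4) (hC' ψ h3 h4)
  · intro p hp
    obtain ⟨e, γ, K, r, he, hγ, hr, h⟩ := hΩl p hp
    have hsub := frontier_inter_ball_subset hΩo he hγ.continuous h
    refine ⟨frontier Ω ∩ Metric.ball p r,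
      inter_mem self_mem_nhdsWithin (mem_nhdsWithin_of_mem_nhds (Metric.ball_mem_nhds p hr)), ?_, ?_⟩
    · exact (measure_mono (subset_inter hsub inter_subset_right)).trans_lt
        (graph_inter_ball_lt_top he hγ p r)
    · obtain ⟨C, hC⟩ := lintegral_graph_le he hγ
      exact ⟨C, fun ψ h1 h2 => (lintegral_mono_set hsub).trans (hC ψ h1 h2)⟩

/-! ### The trace inequality on the lateral boundary -/

lemma gradX_eq {φ : Space n × ℝ → ℝ} (hφ : ContDiff ℝ ∞ φ) :
    gradX φ = fun p => WithLp.toLp 2 fun i => dirDeriv (eX i) φ p := by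
  ext p i
  exact gradX_apply hφ p i

lemma continuous_gradX {φ : Space n × ℝ → ℝ} (hφ : ContDiff ℝ ∞ φ) : Continuous (gradX φ) := by
  rw [gradX_eq hφ]
  exact (PiLp.continuous_toLp 2 _).comp
    (continuous_pi fun i => (contDiff_dirDeriv hφ _).continuous)

lemma hasCompactSupport_gradX {φ : Space n × ℝ → ℝ} (hφ : IsTest φ) :
    HasCompactSupport (gradX φ) := by
  refine HasCompactSupport.intro hφ.2 fun p hp => ?_
  ext i
  rw [gradX_apply hφ.1, dirDeriv_eq_zero_of_notMem_tsupport hp]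
  rfl

lemma exists_lateral_inequality {Ω Γ : Set (Space n)} (hΩo : IsOpen Ω)
    (hΩb : Bornology.IsBounded Ω) (hΩl : HasLipschitzBoundary Ω) (hΓ : Γ ⊆ frontier Ω) (T : ℝ) :
    ∃ C : ℝ≥0, ∀ φ : Space n × ℝ → ℝ, IsTest φ →
      ∫⁻ p, ‖φ p‖ₑ ^ 2 ∂lateral Γ T
        ≤ C * (∫⁻ p, ‖φ p‖ₑ ^ 2 ∂slab n T + ∫⁻ p, ‖gradX φ p‖ₑ ^ 2 ∂slab n T) := by
  obtain ⟨hfin, C, hC⟩ := exists_trace_inequality hΩo hΩb hΩl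
  refine ⟨C, fun φ hφ => ?_⟩
  have : IsFiniteMeasure ((μHE[n - 1] : Measure (Space n)).restrict Γ) :=
    ⟨by rw [Measure.restrict_apply_univ]; exact (measure_mono hΓ).trans_lt hfin⟩
  have hm1 : Measurable fun p => ‖φ p‖ₑ ^ 2 := hφ.1.continuous.measurable.enorm.pow_const 2
  have hm2 : Measurable fun p => ‖gradX φ p‖ₑ ^ 2 :=
    (continuous_gradX hφ.1).measurable.enorm.pow_const 2
  have hm : Measurable fun p => ‖φ p‖ₑ ^ 2 + ‖gradX φ p‖ₑ ^ 2 := hm1.add hm2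
  rw [← lintegral_add_left hm1, lateral, slab, Measure.volume_eq_prod, ← Measure.prod_restrict,
    Measure.restrict_univ, lintegral_prod_symm _ hm1.aemeasurable,
    lintegral_prod_symm _ hm.aemeasurable,
    ← lintegral_const_mul _ hm.lintegral_prod_left']
  refine lintegral_mono fun t => (lintegral_mono_set hΓ).trans ?_
  have h1 : ContDiff ℝ 1 fun x => φ (x, t) := (contDiff_slice_fst hφ.1 t).of_le (by simp)
  have h2 : HasCompactSupport fun x => φ (x, t) :=
    hφ.2.comp_isClosedEmbedding (Isometry.isClosedEmbedding (Isometry.of_dist_eq fun x y => by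
      simp [Prod.dist_eq]))
  refine (hC _ h1 h2).trans (le_of_eq ?_)
  congr 1
  refine lintegral_congr fun x => ?_
  congr 2
  simp only [gradX, gradient, ← ofReal_norm, LinearIsometryEquiv.norm_map]

lemma isFiniteMeasure_restrict_of_subset_frontier {Ω Γ : Set (Space n)} (hΩo : IsOpen Ω)
    (hΩb : Bornology.IsBounded Ω) (hΩl : HasLipschitzBoundary Ω) (hΓ : Γ ⊆ frontier Ω) :
    IsFiniteMeasure ((μHE[n - 1] : Measure (Space n)).restrict Γ) :=
  ⟨by rw [Measure.restrict_apply_univ]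
      exact (measure_mono hΓ).trans_lt (exists_trace_inequality hΩo hΩb hΩl).1⟩

end Trace

/-! ### The solution operator -/

section Solution

variable {n : ℕ}

lemma norm_toLp_sq {α F : Type*} [MeasurableSpace α] {μ : Measure α} [NormedAddCommGroup F]
    [InnerProductSpace ℝ F] {f : α → F} (hf : MemLp f 2 μ) :
    ‖hf.toLp f‖ ^ 2 = ∫ x, ‖f x‖ ^ 2 ∂μ := by
  rw [← real_inner_self_eq_norm_sq, L2.inner_def]
  refine integral_congr_ae ?_
  filter_upwards [hf.coeFn_toLp] with x hx
  rw [hx, real_inner_self_eq_norm_sq]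

lemma inner_toLp {α F : Type*} [MeasurableSpace α] {μ : Measure α} [NormedAddCommGroup F]
    [InnerProductSpace ℝ F] {f : α → F} (hf : MemLp f 2 μ) (g : Lp F 2 μ) :
    inner ℝ (hf.toLp f) g = ∫ x, inner ℝ (f x) (g x) ∂μ := by
  rw [L2.inner_def]
  refine integral_congr_ae ?_
  filter_upwards [hf.coeFn_toLp] with x hx
  rw [hx]

lemma inner_toLp_real {α : Type*} [MeasurableSpace α] {μ : Measure α} {f : α → ℝ}
    (hf : MemLp f 2 μ) (g : Lp ℝ 2 μ) : inner ℝ (hf.toLp f) g = ∫ x, g x * f x ∂μ := by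
  rw [inner_toLp]
  rfl

lemma dirDeriv_add {f g : Space n × ℝ → ℝ} (hf : ContDiff ℝ ∞ f) (hg : ContDiff ℝ ∞ g)
    (v : Space n × ℝ) : dirDeriv v (f + g) = dirDeriv v f + dirDeriv v g := by
  ext p
  simp [dirDeriv, fderiv_add (hf.differentiable (by simp) p) (hg.differentiable (by simp) p)]

lemma dirDeriv_smul {f : Space n × ℝ → ℝ} (hf : ContDiff ℝ ∞ f) (r : ℝ)
    (v : Space n × ℝ) : dirDeriv v (r • f) = r • dirDeriv v f := by
  ext p
  simp [dirDeriv, fderiv_const_smul (hf.differentiable (by simp) p)]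

lemma waveOp_add (c : ℝ) {f g : Space n × ℝ → ℝ} (hf : ContDiff ℝ ∞ f) (hg : ContDiff ℝ ∞ g) :
    waveOp c (f + g) = waveOp c f + waveOp c g := by
  ext p
  have hfg : ContDiff ℝ ∞ (f + g) := hf.add hg
  rw [Pi.add_apply, waveOp_eq c hfg, waveOp_eq c hf, waveOp_eq c hg]
  simp only [dirDeriv_add hf hg, dirDeriv_add (contDiff_dirDeriv hf _) (contDiff_dirDeriv hg _),
    Pi.add_apply, Finset.sum_add_distrib]
  ring

lemma waveOp_smul (c : ℝ) {f : Space n × ℝ → ℝ} (hf : ContDiff ℝ ∞ f) (r : ℝ) :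
    waveOp c (r • f) = r • waveOp c f := by
  ext p
  have hrf : ContDiff ℝ ∞ (r • f) := contDiff_const.smul hf
  rw [Pi.smul_apply, waveOp_eq c hrf, waveOp_eq c hf]
  simp only [dirDeriv_smul hf, dirDeriv_smul (contDiff_dirDeriv hf _), Pi.smul_apply, smul_eq_mul,
    ← Finset.mul_sum]
  ring

lemma gradX_add {f g : Space n × ℝ → ℝ} (hf : ContDiff ℝ ∞ f) (hg : ContDiff ℝ ∞ g) :
    gradX (f + g) = gradX f + gradX g := by
  have hfg : ContDiff ℝ ∞ (f + g) := hf.add hg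
  ext p i
  simp [gradX_apply hfg, gradX_apply hf, gradX_apply hg, dirDeriv_add hf hg]

lemma gradX_smul {f : Space n × ℝ → ℝ} (hf : ContDiff ℝ ∞ f) (r : ℝ) :
    gradX (r • f) = r • gradX f := by
  have hrf : ContDiff ℝ ∞ (r • f) := contDiff_const.smul hf
  ext p i
  rw [gradX_apply hrf, dirDeriv_smul hf]
  simp [gradX_apply hf]

/-- The space of test functions. -/
def testSpace (n : ℕ) : Submodule ℝ (Space n × ℝ → ℝ) where
  carrier := {φ | IsTest φ}
  add_mem' hf hg := ⟨hf.1.add hg.1, hf.2.add hg.2⟩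
  zero_mem' := ⟨contDiff_const, HasCompactSupport.zero⟩
  smul_mem' r _ hf := ⟨contDiff_const.smul hf.1, hf.2.smul_left (f := fun _ => r)⟩

/-- The test functions supported in positive times. -/
def posTestSpace (n : ℕ) : Submodule ℝ (testSpace n) where
  carrier := {φ | tsupport φ.1 ⊆ univ ×ˢ Ioi 0}
  add_mem' {f g} hf hg := (tsupport_add f.1 g.1).trans (union_subset hf hg)
  zero_mem' := by simp [tsupport]
  smul_mem' r f hf := (tsupport_smul_subset_right (fun _ => r) f.1).trans hf

instance (T : ℝ) : IsFiniteMeasureOnCompacts (slab n T) := by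
  unfold slab; infer_instance

lemma IsTest.memLp {φ : Space n × ℝ → ℝ} (hφ : IsTest φ) (μ : Measure (Space n × ℝ))
    [IsFiniteMeasureOnCompacts μ] : MemLp φ 2 μ :=
  hφ.1.continuous.memLp_of_hasCompactSupport hφ.2

lemma IsTest.memLp_gradX {φ : Space n × ℝ → ℝ} (hφ : IsTest φ) (T : ℝ) :
    MemLp (gradX φ) 2 (slab n T) :=
  (continuous_gradX hφ.1).memLp_of_hasCompactSupport (hasCompactSupport_gradX hφ)

/-- Test functions as elements of `L²`. -/
def testToLp (μ : Measure (Space n × ℝ)) [IsFiniteMeasureOnCompacts μ] :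
    testSpace n →ₗ[ℝ] Lp ℝ 2 μ where
  toFun φ := (φ.2.memLp μ).toLp φ.1
  map_add' _ _ := MemLp.toLp_add _ _
  map_smul' r _ := MemLp.toLp_const_smul r _

/-- The image of test functions under the wave operator. -/
def waveToLp (c T : ℝ) : testSpace n →ₗ[ℝ] L2Slab n T where
  toFun φ := ((isTest_waveOp c φ.2).memLp (slab n T)).toLp (waveOp c φ.1)
  map_add' f g := by
    rw [← MemLp.toLp_add]
    congr 1
    exact waveOp_add c f.2.1 g.2.1
  map_smul' r f := by
    rw [RingHom.id_apply, ← MemLp.toLp_const_smul]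
    congr 1
    exact waveOp_smul c f.2.1 r

/-- The spatial gradients of test functions. -/
def gradToLp (T : ℝ) : testSpace n →ₗ[ℝ] Lp (Space n) 2 (slab n T) where
  toFun φ := (φ.2.memLp_gradX T).toLp (gradX φ.1)
  map_add' f g := by
    rw [← MemLp.toLp_add]
    congr 1
    exact gradX_add f.2.1 g.2.1
  map_smul' r f := by
    rw [RingHom.id_apply, ← MemLp.toLp_const_smul]
    congr 1
    exact gradX_smul f.2.1 r

lemma inner_waveToLp (c T : ℝ) (φ : testSpace n) (W : L2Slab n T) :
    inner ℝ (waveToLp c T φ) W = ∫ p, W p * waveOp c φ.1 p ∂slab n T :=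
  inner_toLp_real ((isTest_waveOp c φ.2).memLp (slab n T)) W

lemma inner_testToLp (μ : Measure (Space n × ℝ)) [IsFiniteMeasureOnCompacts μ] (φ : testSpace n)
    (V : Lp ℝ 2 μ) : inner ℝ (testToLp μ φ) V = ∫ p, V p * φ.1 p ∂μ :=
  inner_toLp_real (φ.2.memLp μ) V

lemma norm_testToLp_sq (μ : Measure (Space n × ℝ)) [IsFiniteMeasureOnCompacts μ]
    (φ : testSpace n) : ‖testToLp μ φ‖ ^ 2 = ∫ p, φ.1 p ^ 2 ∂μ := by
  refine (norm_toLp_sq (φ.2.memLp μ)).trans ?_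
  simp

lemma norm_waveToLp_sq (c T : ℝ) (φ : testSpace n) :
    ‖waveToLp c T φ‖ ^ 2 = ∫ p, waveOp c φ.1 p ^ 2 ∂slab n T := by
  refine (norm_toLp_sq ((isTest_waveOp c φ.2).memLp (slab n T))).trans ?_
  simp

lemma norm_gradToLp_sq (T : ℝ) (φ : testSpace n) :
    ‖gradToLp T φ‖ ^ 2 = ∫ p, ‖gradX φ.1 p‖ ^ 2 ∂slab n T :=
  norm_toLp_sq (φ.2.memLp_gradX T)

/-- Linear maps into a normed space. -/
abbrev NormedLin (E F : Type*) [AddCommGroup E] [Module ℝ E] [NormedAddCommGroup F]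
    [NormedSpace ℝ F] : Type _ := E →ₗ[ℝ] F

/-- The image under the wave operator of the test functions supported in positive times. -/
def posWave (c T : ℝ) : NormedLin (posTestSpace n) (L2Slab n T) :=
  (waveToLp c T).comp (posTestSpace n).subtype

/-- Orthogonality to the range is the weak backward problem with zero source; uniqueness makes the
orthogonal complement trivial. -/
lemma denseRange_posWave {c T : ℝ} (hc : 0 < c) : DenseRange (posWave (n := n) c T) := by
  have h : (LinearMap.range (posWave (n := n) c T))ᗮ = ⊥ := by
    rw [Submodule.eq_bot_iff]
    intro W hW
    rw [Submodule.mem_orthogonal] at hW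
    rw [Lp.eq_zero_iff_ae_eq_zero]
    refine slab_backward_unique hc (Lp.memLp W) fun φ hφ hs => ?_
    rw [← inner_waveToLp c T ⟨φ, hφ⟩ W]
    exact hW _ ⟨⟨⟨φ, hφ⟩, hs⟩, rfl⟩
  rw [← Submodule.topologicalClosure_eq_top_iff] at h
  intro x
  have hx : x ∈ (LinearMap.range (posWave (n := n) c T)).topologicalClosure := by rw [h]; trivial
  exact hx

/-- A test function, its spatial gradient and its trace. -/
def sobolevData (Γ : Set (Space n)) (T : ℝ) [IsFiniteMeasureOnCompacts (lateral Γ T)] :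
    testSpace n →ₗ[ℝ] L2Slab n T × Lp (Space n) 2 (slab n T) × L2Lat Γ T :=
  (testToLp (slab n T)).prod ((gradToLp T).prod (testToLp (lateral Γ T)))

/-- The restriction of `sobolevData` to the test functions supported in positive times. -/
def posSobolevData (Γ : Set (Space n)) (T : ℝ) [IsFiniteMeasureOnCompacts (lateral Γ T)] :
    NormedLin (posTestSpace n) (L2Slab n T × Lp (Space n) 2 (slab n T) × L2Lat Γ T) :=
  (sobolevData Γ T).comp (posTestSpace n).subtype

lemma isFiniteMeasure_lateral {Ω Γ : Set (Space n)} (hΩo : IsOpen Ω)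
    (hΩb : Bornology.IsBounded Ω) (hΩl : HasLipschitzBoundary Ω) (hΓ : Γ ⊆ frontier Ω) (T : ℝ) :
    IsFiniteMeasure (lateral Γ T) := by
  have := isFiniteMeasure_restrict_of_subset_frontier hΩo hΩb hΩl hΓ
  unfold lateral
  infer_instance

lemma lintegral_enorm_sq_eq {F : Type*} [NormedAddCommGroup F] [InnerProductSpace ℝ F]
    {μ : Measure (Space n × ℝ)} {f : Space n × ℝ → F} (hf : MemLp f 2 μ) :
    ∫⁻ p, ‖f p‖ₑ ^ 2 ∂μ = ENNReal.ofReal (∫ p, ‖f p‖ ^ 2 ∂μ) := by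
  rw [ofReal_integral_eq_lintegral_ofReal (by simpa using hf.integrable_norm_pow (by norm_num))
    (Eventually.of_forall fun p => by positivity)]
  exact lintegral_congr fun p => by
    rw [← ofReal_norm, ← ENNReal.ofReal_pow (norm_nonneg _)]

lemma exists_norm_trace_le {Ω Γ : Set (Space n)} (hΩo : IsOpen Ω)
    (hΩb : Bornology.IsBounded Ω) (hΩl : HasLipschitzBoundary Ω) (hΓ : Γ ⊆ frontier Ω) (T : ℝ)
    [IsFiniteMeasureOnCompacts (lateral Γ T)] :
    ∃ C : ℝ, 0 ≤ C ∧ ∀ φ : testSpace n, ‖testToLp (lateral Γ T) φ‖ ^ 2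
      ≤ C * (‖testToLp (slab n T) φ‖ ^ 2 + ‖gradToLp T φ‖ ^ 2) := by
  obtain ⟨C, hC⟩ := exists_lateral_inequality hΩo hΩb hΩl hΓ T
  refine ⟨C, C.2, fun φ => ?_⟩
  have h := hC φ.1 φ.2
  rw [lintegral_enorm_sq_eq (φ.2.memLp _), lintegral_enorm_sq_eq (φ.2.memLp _),
    lintegral_enorm_sq_eq (φ.2.memLp_gradX T), ← ENNReal.ofReal_add (by positivity) (by positivity),
    ← ENNReal.ofReal_coe_nnreal, ← ENNReal.ofReal_mul (NNReal.coe_nonneg C),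
    ENNReal.ofReal_le_ofReal_iff (by positivity)] at h
  rw [norm_gradToLp_sq, norm_testToLp_sq, norm_testToLp_sq]
  simpa using h

lemma exists_norm_sobolevData_le {c T : ℝ} (hc : 0 < c) (hT : 0 < T) {Ω Γ : Set (Space n)}
    (hΩo : IsOpen Ω) (hΩb : Bornology.IsBounded Ω) (hΩl : HasLipschitzBoundary Ω)
    (hΓ : Γ ⊆ frontier Ω) [IsFiniteMeasureOnCompacts (lateral Γ T)] :
    ∃ C : ℝ, ∀ φ : posTestSpace n,
      ‖posSobolevData Γ T φ‖ ≤ C * ‖posWave c T φ‖ := by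
  obtain ⟨C, hC0, hC⟩ := exists_wave_estimate (n := n) hc hT
  obtain ⟨D, hD0, hD⟩ := exists_norm_trace_le hΩo hΩb hΩl hΓ T
  -- `C` bounds the function and the gradient, `D (C + C)` the trace; the sum dominates each, as the
  -- product norm is a maximum.
  refine ⟨√(C + D * (C + C)), fun φ => ?_⟩
  obtain ⟨h1, h2⟩ := hC φ.1.1 φ.1.2 φ.2
  have h3 := hD φ.1
  rw [← norm_testToLp_sq (slab n T), ← norm_waveToLp_sq] at h1
  rw [← norm_gradToLp_sq, ← norm_waveToLp_sq] at h2
  have hle : ∀ a : ℝ, 0 ≤ a → a ^ 2 ≤ (C + D * (C + C)) * ‖waveToLp c T φ.1‖ ^ 2 →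
      a ≤ √(C + D * (C + C)) * ‖posWave c T φ‖ := by
    intro a ha h
    refine abs_le_of_sq_le_sq' ?_ (by positivity) |>.2
    rwa [mul_pow, Real.sq_sqrt (by positivity)]
  have hm : C * ‖waveToLp c T φ.1‖ ^ 2 ≤ (C + D * (C + C)) * ‖waveToLp c T φ.1‖ ^ 2 := by
    gcongr; have : 0 ≤ D * (C + C) := by positivity
    linarith
  have h4 : ‖testToLp (lateral Γ T) φ.1‖ ^ 2
      ≤ (C + D * (C + C)) * ‖waveToLp c T φ.1‖ ^ 2 := by
    refine h3.trans ?_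
    calc _ ≤ D * (C * ‖waveToLp c T φ.1‖ ^ 2 + C * ‖waveToLp c T φ.1‖ ^ 2) := by gcongr
      _ = D * (C + C) * ‖waveToLp c T φ.1‖ ^ 2 := by ring
      _ ≤ _ := by gcongr; linarith
  refine max_le (hle _ (norm_nonneg _) (h1.trans hm))
    (max_le (hle _ (norm_nonneg _) (h2.trans hm)) (hle _ (norm_nonneg _) h4))

section Extend

variable {E E' F : Type*} [AddCommGroup E] [Module ℝ E] [NormedAddCommGroup E'] [NormedSpace ℝ E']
  [NormedAddCommGroup F] [NormedSpace ℝ F] [CompleteSpace F]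

/-- The continuous extension of `e x ↦ f x` from the range of `e`. -/
def extendDense (f : NormedLin E F) (e : NormedLin E E') : E' →L[ℝ] F := f.extendOfNorm e

lemma extendDense_apply {f : NormedLin E F} {e : NormedLin E E'} (hd : DenseRange e)
    (h : ∃ C : ℝ, ∀ x, ‖f x‖ ≤ C * ‖e x‖) (x : E) : extendDense f e (e x) = f x :=
  LinearMap.extendOfNorm_eq hd h x

end Extend

/-- The solution operator of the direct problem: the source is mapped to the solution, its spatial
gradient and its trace. -/
def solutionOp (c T : ℝ) (Γ : Set (Space n)) [IsFiniteMeasureOnCompacts (lateral Γ T)] :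
    L2Slab n T →L[ℝ] L2Slab n T × Lp (Space n) 2 (slab n T) × L2Lat Γ T :=
  extendDense (E := posTestSpace n) (E' := L2Slab n T) (posSobolevData Γ T) (posWave c T)

lemma solutionOp_posWave {c T : ℝ} (hc : 0 < c) (hT : 0 < T) {Ω Γ : Set (Space n)}
    (hΩo : IsOpen Ω) (hΩb : Bornology.IsBounded Ω) (hΩl : HasLipschitzBoundary Ω)
    (hΓ : Γ ⊆ frontier Ω) [IsFiniteMeasureOnCompacts (lateral Γ T)] (φ : posTestSpace n) :
    solutionOp c T Γ (posWave c T φ) = sobolevData Γ T φ.1 :=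
  extendDense_apply (E := posTestSpace n) (E' := L2Slab n T) (f := posSobolevData Γ T)
    (e := posWave c T) (denseRange_posWave (n := n) hc) (exists_norm_sobolevData_le hc hT hΩo hΩb hΩl hΓ) φ

/-- A field with square integrable gradient and trace, approximated by test functions. -/
def IsSobolevLimit {Γ : Set (Space n)} {T : ℝ} [IsFiniteMeasureOnCompacts (lateral Γ T)]
    (S : L2Slab n T × Lp (Space n) 2 (slab n T) × L2Lat Γ T) : Prop :=
  ∃ φ : ℕ → testSpace n, Tendsto (fun k => sobolevData Γ T (φ k)) atTop (𝓝 S)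

/-- Approximate the source by `□φₖ`; continuity gives convergence of `φₖ`, its gradient and its
trace at once. -/
lemma isSobolevLimit_solutionOp {c T : ℝ} (hc : 0 < c) {Γ : Set (Space n)}
    [IsFiniteMeasureOnCompacts (lateral Γ T)]
    (hS : ∀ φ : posTestSpace n, solutionOp c T Γ (posWave c T φ) = sobolevData Γ T φ.1)
    (h : L2Slab n T) : IsSobolevLimit (solutionOp c T Γ h) := by
  obtain ⟨u, hu, hlim⟩ := mem_closure_iff_seq_limit.1 (denseRange_posWave (n := n) (T := T) hc h)
  choose φ hφ using hu
  refine ⟨fun k => (φ k).1, ?_⟩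
  simp_rw [← hS, hφ]
  exact ((solutionOp c T Γ).continuous.tendsto h).comp hlim

/-! ### Passage to the limit in the weak formulations -/

lemma integral_mul_dirDeriv {f g : Space n × ℝ → ℝ} (hf : IsTest f) (hg : IsTest g)
    (v : Space n × ℝ) : ∫ p, f p * dirDeriv v g p = - ∫ p, dirDeriv v f p * g p :=
  integral_mul_fderiv_eq_neg_fderiv_mul_of_integrable
    ((isTest_mul (isTest_dirDeriv hf v) hg.1).1.continuous.integrable_of_hasCompactSupport
      (isTest_mul (isTest_dirDeriv hf v) hg.1).2)
    ((isTest_mul hf (contDiff_dirDeriv hg.1 v)).1.continuous.integrable_of_hasCompactSupport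
      (isTest_mul hf (contDiff_dirDeriv hg.1 v)).2)
    ((isTest_mul hf hg.1).1.continuous.integrable_of_hasCompactSupport (isTest_mul hf hg.1).2)
    (fun p _ => hf.1.differentiable (by simp) p) (fun p _ => hg.1.differentiable (by simp) p)

lemma integral_mul_waveOp (c : ℝ) {f g : Space n × ℝ → ℝ} (hf : IsTest f) (hg : IsTest g) :
    ∫ p, f p * waveOp c g p = ∫ p, waveOp c f p * g p := by
  have hi : ∀ {f g : Space n × ℝ → ℝ}, IsTest f → IsTest g → Integrable fun p => f p * g p :=
    fun hf hg => (isTest_mul hf hg.1).1.continuous.integrable_of_hasCompactSupport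
      (isTest_mul hf hg.1).2
  have hdd : ∀ {f : Space n × ℝ → ℝ}, IsTest f → ∀ v, IsTest (dirDeriv v (dirDeriv v f)) :=
    fun hf v => isTest_dirDeriv (isTest_dirDeriv hf v) v
  have h2 : ∀ v, ∫ p, f p * dirDeriv v (dirDeriv v g) p = ∫ p, dirDeriv v (dirDeriv v f) p * g p :=
    fun v => by
      rw [integral_mul_dirDeriv hf (isTest_dirDeriv hg v),
        integral_mul_dirDeriv (isTest_dirDeriv hf v) hg, neg_neg]
  simp_rw [waveOp_eq c hf.1, waveOp_eq c hg.1, mul_sub, sub_mul, Finset.mul_sum, Finset.sum_mul,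
    mul_left_comm (f _), mul_assoc]
  rw [integral_sub ((hi hf (hdd hg _)).const_mul _)
      (integrable_finsetSum _ fun i _ => hi hf (hdd hg _)),
    integral_sub ((hi (hdd hf _) hg).const_mul _)
      (integrable_finsetSum _ fun i _ => hi (hdd hf _) hg),
    integral_const_mul, integral_const_mul, integral_finsetSum _ fun i _ => hi hf (hdd hg _),
    integral_finsetSum _ fun i _ => hi (hdd hf _) hg]
  simp_rw [h2]

lemma integral_slab_eq_integral {T : ℝ} {F : Space n × ℝ → ℝ}
    (h0 : ∀ p : Space n × ℝ, p.2 ≤ 0 → F p = 0) (hT : ∀ p : Space n × ℝ, T < p.2 → F p = 0) :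
    ∫ p, F p ∂slab n T = ∫ p, F p := by
  refine setIntegral_eq_integral_of_forall_compl_eq_zero fun p hp => ?_
  rcases le_or_gt p.2 0 with h | h
  · exact h0 p h
  · exact hT p (not_le.1 fun h2 => hp ⟨mem_univ _, h, h2⟩)

lemma eq_zero_of_tsupport_subset_Iio {φ : Space n × ℝ → ℝ} {b : ℝ}
    (h0 : tsupport φ ⊆ univ ×ˢ Iio b) (p : Space n × ℝ) (hp : b ≤ p.2) : p ∉ tsupport φ :=
  fun h => not_lt.2 hp (h0 h).2

/-- `φ` vanishes near `t ≤ 0` and `ψ` near `t ≥ T`, so both integrals extend to all of space-time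
and no boundary terms arise. -/
lemma integral_slab_mul_waveOp (c : ℝ) {T : ℝ} {φ ψ : Space n × ℝ → ℝ} (hφ : IsTest φ)
    (hφ0 : tsupport φ ⊆ univ ×ˢ Ioi 0) (hψ : IsTest ψ) (hψT : tsupport ψ ⊆ univ ×ˢ Iio T) :
    ∫ p, φ p * waveOp c ψ p ∂slab n T = ∫ p, waveOp c φ p * ψ p ∂slab n T := by
  have h1 : ∀ p : Space n × ℝ, p.2 ≤ 0 → p ∉ tsupport φ := fun p hp h => not_lt.2 hp (hφ0 h).2
  have h2 := eq_zero_of_tsupport_subset_Iio hψT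
  rw [integral_slab_eq_integral, integral_slab_eq_integral, integral_mul_waveOp c hφ hψ]
  · exact fun p hp => by rw [waveOp_eq_zero_of_notMem_tsupport c hφ.1 (h1 p hp), zero_mul]
  · exact fun p hp => by rw [image_eq_zero_of_notMem_tsupport (h2 p hp.le), mul_zero]
  · exact fun p hp => by rw [image_eq_zero_of_notMem_tsupport (h1 p hp), zero_mul]
  · exact fun p hp => by rw [waveOp_eq_zero_of_notMem_tsupport c hψ.1 (h2 p hp.le), mul_zero]

lemma integral_slab_mul_dirDeriv {T : ℝ} {φ ψ : Space n × ℝ → ℝ} (hφ : IsTest φ)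
    (hψ : IsTest ψ) (hψT : tsupport ψ ⊆ univ ×ˢ Ioo 0 T) (v : Space n × ℝ) :
    ∫ p, φ p * dirDeriv v ψ p ∂slab n T = - ∫ p, dirDeriv v φ p * ψ p ∂slab n T := by
  have h1 : ∀ p : Space n × ℝ, p.2 ≤ 0 → p ∉ tsupport ψ := fun p hp h => not_lt.2 hp (hψT h).2.1
  have h2 : ∀ p : Space n × ℝ, T < p.2 → p ∉ tsupport ψ := fun p hp h =>
    lt_asymm hp (hψT h).2.2
  rw [integral_slab_eq_integral, integral_slab_eq_integral, integral_mul_dirDeriv hφ hψ v]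
  · exact fun p hp => by rw [image_eq_zero_of_notMem_tsupport (h1 p hp), mul_zero]
  · exact fun p hp => by rw [image_eq_zero_of_notMem_tsupport (h2 p hp), mul_zero]
  · exact fun p hp => by rw [dirDeriv_eq_zero_of_notMem_tsupport (h1 p hp), mul_zero]
  · exact fun p hp => by rw [dirDeriv_eq_zero_of_notMem_tsupport (h2 p hp), mul_zero]

/-- The weak gradient is a closed operator: component by component, integration by parts for test
functions is an equality of inner products and survives the limit. -/
lemma IsSobolevLimit.isWeakGradX {Γ : Set (Space n)} {T : ℝ}
    [IsFiniteMeasureOnCompacts (lateral Γ T)]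
    {S : L2Slab n T × Lp (Space n) 2 (slab n T) × L2Lat Γ T} (hS : IsSobolevLimit S) :
    IsWeakGradX T S.1 S.2.1 := by
  refine ⟨Lp.memLp _, fun ψ hψ hs => ?_⟩
  obtain ⟨φ, hφ⟩ := hS
  have hφ1 : Tendsto (fun k => testToLp (slab n T) (φ k)) atTop (𝓝 S.1) :=
    (continuous_fst.tendsto S).comp hφ
  have hφ2 : Tendsto (fun k => gradToLp T (φ k)) atTop (𝓝 S.2.1) :=
    ((continuous_fst.comp continuous_snd).tendsto S).comp hφ
  have hψg : MemLp ψ 2 (slab n T) := hψ.memLp _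
  have hint1 : Integrable (fun p => S.1 p • gradX ψ p) (slab n T) :=
    memLp_one_iff_integrable.1 ((hψ.memLp_gradX T).smul (r := 1) (Lp.memLp S.1))
  have hint2 : Integrable (fun p => ψ p • S.2.1 p) (slab n T) :=
    memLp_one_iff_integrable.1 ((Lp.memLp S.2.1).smul (r := 1) hψg)
  ext i
  have hD : MemLp (dirDeriv (eX i) ψ) 2 (slab n T) := (isTest_dirDeriv hψ _).memLp _
  have hψe : MemLp (fun p => ψ p • (EuclideanSpace.single i (1 : ℝ) : Space n)) 2 (slab n T) :=
    (hψ.1.continuous.smul continuous_const).memLp_of_hasCompactSupport hψ.2.smul_right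
  have key : inner ℝ (hD.toLp _) S.1 = - inner ℝ (hψe.toLp _) S.2.1 := by
    have h1 : Tendsto (fun k => inner ℝ (hD.toLp _) (testToLp (slab n T) (φ k))) atTop
        (𝓝 (inner ℝ (hD.toLp _) S.1)) := tendsto_const_nhds.inner hφ1
    have h2 : Tendsto (fun k => - inner ℝ (hψe.toLp _) (gradToLp T (φ k))) atTop
        (𝓝 (- inner ℝ (hψe.toLp _) S.2.1)) := (tendsto_const_nhds.inner hφ2).neg
    refine tendsto_nhds_unique h1 (h2.congr fun k => ?_)
    rw [inner_toLp, inner_toLp_real]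
    have h3 : ∫ p, testToLp (slab n T) (φ k) p * dirDeriv (eX i) ψ p ∂slab n T
        = ∫ p, (φ k).1 p * dirDeriv (eX i) ψ p ∂slab n T := by
      refine integral_congr_ae ?_
      filter_upwards [((φ k).2.memLp (slab n T)).coeFn_toLp] with p hp
      rw [← hp]; rfl
    rw [h3, integral_slab_mul_dirDeriv (φ k).2 hψ hs]
    congr 1
    refine integral_congr_ae ?_
    filter_upwards [((φ k).2.memLp_gradX T).coeFn_toLp] with p hp
    have h4 : (gradToLp T (φ k)) p = gradX (φ k).1 p := hp
    rw [h4, inner_smul_left, EuclideanSpace.inner_single_left, gradX_apply (φ k).2.1]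
    simp [mul_comm]
  rw [inner_toLp_real, inner_toLp] at key
  have hL1 := (EuclideanSpace.proj (𝕜 := ℝ) i : Space n →L[ℝ] ℝ).integral_comp_comm hint1
  have hL2 := (EuclideanSpace.proj (𝕜 := ℝ) i : Space n →L[ℝ] ℝ).integral_comp_comm hint2
  refine hL1.symm.trans (Eq.trans ?_ (key.trans (Eq.trans ?_ (congrArg Neg.neg hL2))))
  · refine integral_congr_ae (Eventually.of_forall fun p => ?_)
    simp [gradX_apply hψ.1]
  · congr 1
    refine integral_congr_ae (Eventually.of_forall fun p => ?_)
    simp [inner_smul_left, EuclideanSpace.inner_single_left]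

/-- Both sides are continuous in `h`, and for `h = □φ` they agree by symmetry of □. -/
lemma inner_waveToLp_solutionOp {c T : ℝ} (hc : 0 < c) {Γ : Set (Space n)}
    [IsFiniteMeasureOnCompacts (lateral Γ T)]
    (hS : ∀ φ : posTestSpace n, solutionOp c T Γ (posWave c T φ) = sobolevData Γ T φ.1)
    {ψ : testSpace n} (hψ : tsupport ψ.1 ⊆ univ ×ˢ Iio T) (h : L2Slab n T) :
    inner ℝ (waveToLp c T ψ) (solutionOp c T Γ h).1 = inner ℝ (testToLp (slab n T) ψ) h := by
  refine congrFun ((denseRange_posWave (n := n) (T := T) hc).equalizer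
    (g := fun h => inner ℝ (waveToLp c T ψ) (solutionOp c T Γ h).1)
    (h := fun h => inner ℝ (testToLp (slab n T) ψ) h) ?_ ?_ ?_) h
  · exact continuous_const.inner (continuous_fst.comp (solutionOp c T Γ).continuous)
  · exact continuous_const.inner continuous_id
  · ext φ
    simp only [Function.comp, hS]
    rw [inner_waveToLp, inner_testToLp]
    have h1 := integral_slab_mul_waveOp c φ.1.2 φ.2 ψ.2 hψ
    refine Eq.trans ?_ (h1.trans ?_)
    · refine integral_congr_ae ?_
      filter_upwards [(φ.1.2.memLp (slab n T)).coeFn_toLp] with p hp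
      rw [← hp]; rfl
    · refine integral_congr_ae ?_
      filter_upwards [((isTest_waveOp c φ.1.2).memLp (slab n T)).coeFn_toLp] with p hp
      rw [← hp]; rfl

lemma isTrace_iff {Γ : Set (Space n)} {T : ℝ} [IsFiniteMeasureOnCompacts (lateral Γ T)]
    {U : L2Slab n T} {v : L2Lat Γ T} : IsTrace U v ↔
      ∃ G : Lp (Space n) 2 (slab n T), IsSobolevLimit (U, G, v) := by
  constructor
  · rintro ⟨G, φ, hG, hφ, h1, h2, h3⟩
    refine ⟨hG.1.toLp G, fun k => ⟨φ k, hφ k⟩, ?_⟩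
    refine (Tendsto.prodMk_nhds ?_ (Tendsto.prodMk_nhds ?_ ?_))
    · rw [← Lp.toLp_coeFn U (Lp.memLp U)]
      exact (Lp.tendsto_Lp_iff_tendsto_eLpNorm'' _ (fun k => (hφ k).memLp _) _ (Lp.memLp U)).2 h1
    · exact (Lp.tendsto_Lp_iff_tendsto_eLpNorm'' _ (fun k => (hφ k).memLp_gradX T) _ hG.1).2 h2
    · rw [← Lp.toLp_coeFn v (Lp.memLp v)]
      exact (Lp.tendsto_Lp_iff_tendsto_eLpNorm'' _ (fun k => (hφ k).memLp _) _ (Lp.memLp v)).2 h3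
  · rintro ⟨G, hS⟩
    have hG := hS.isWeakGradX
    obtain ⟨φ, hφ⟩ := hS
    have h1 : Tendsto (fun k => testToLp (slab n T) (φ k)) atTop (𝓝 U) :=
      (continuous_fst.tendsto _).comp hφ
    have h2 : Tendsto (fun k => gradToLp T (φ k)) atTop (𝓝 G) :=
      ((continuous_fst.comp continuous_snd).tendsto _).comp hφ
    have h3 : Tendsto (fun k => testToLp (lateral Γ T) (φ k)) atTop (𝓝 v) :=
      ((continuous_snd.comp continuous_snd).tendsto _).comp hφ
    rw [← Lp.toLp_coeFn U (Lp.memLp U)] at h1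
    rw [← Lp.toLp_coeFn G (Lp.memLp G)] at h2
    rw [← Lp.toLp_coeFn v (Lp.memLp v)] at h3
    refine ⟨G, fun k => (φ k).1, hG, fun k => (φ k).2, ?_, ?_, ?_⟩
    · exact (Lp.tendsto_Lp_iff_tendsto_eLpNorm'' _ (fun k => (φ k).2.memLp _) _ (Lp.memLp U)).1 h1
    · exact (Lp.tendsto_Lp_iff_tendsto_eLpNorm'' _ (fun k => (φ k).2.memLp_gradX T) _
        (Lp.memLp G)).1 h2
    · exact (Lp.tendsto_Lp_iff_tendsto_eLpNorm'' _ (fun k => (φ k).2.memLp _) _ (Lp.memLp v)).1 h3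

/-- Both approximating sequences converge to the same `U` and, by uniqueness of weak gradients, to
the same gradient. The trace inequality for their difference forces equal traces. -/
lemma isTrace_unique {Ω Γ : Set (Space n)} (hΩo : IsOpen Ω)
    (hΩb : Bornology.IsBounded Ω) (hΩl : HasLipschitzBoundary Ω) (hΓ : Γ ⊆ frontier Ω) {T : ℝ}
    [IsFiniteMeasureOnCompacts (lateral Γ T)] {U : L2Slab n T} {v v' : L2Lat Γ T}
    (h : IsTrace U v) (h' : IsTrace U v') : v = v' := by
  obtain ⟨C, hC0, hC⟩ := exists_norm_trace_le hΩo hΩb hΩl hΓ T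
  obtain ⟨G, hS⟩ := isTrace_iff.1 h
  obtain ⟨G', hS'⟩ := isTrace_iff.1 h'
  have hGG : G = G' := Lp.ext (weakGradX_unique hS.isWeakGradX hS'.isWeakGradX)
  obtain ⟨φ, hφ⟩ := hS
  obtain ⟨φ', hφ'⟩ := hS'
  have hd := hφ.sub hφ'
  simp_rw [← map_sub] at hd
  rw [hGG] at hd
  have h1 : Tendsto (fun k => testToLp (slab n T) (φ k - φ' k)) atTop (𝓝 (U - U)) :=
    (continuous_fst.tendsto _).comp hd
  have h2 : Tendsto (fun k => gradToLp T (φ k - φ' k)) atTop (𝓝 (G' - G')) :=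
    ((continuous_fst.comp continuous_snd).tendsto _).comp hd
  have h3 : Tendsto (fun k => testToLp (lateral Γ T) (φ k - φ' k)) atTop (𝓝 (v - v')) :=
    ((continuous_snd.comp continuous_snd).tendsto _).comp hd
  have h4 := ((h1.norm.pow 2).add (h2.norm.pow 2)).const_mul C
  have h5 := le_of_tendsto_of_tendsto' (h3.norm.pow 2) h4 fun k => hC (φ k - φ' k)
  simp only [sub_self, norm_zero] at h5
  have h6 : ‖v - v'‖ ^ 2 ≤ 0 := by simpa using h5
  exact sub_eq_zero.1 (norm_eq_zero.1 (pow_eq_zero_iff two_ne_zero |>.1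
    (le_antisymm h6 (sq_nonneg _))))

end Solution

/-! ### The source operator -/

section Source

variable {n : ℕ}

lemma cylinder_eq_prod (Ω : Set (Space n)) (T : ℝ) :
    cylinder Ω T = ((volume : Measure (Space n)).restrict Ω).prod
      ((volume : Measure ℝ).restrict (Ioc 0 T)) := by
  rw [cylinder, Measure.volume_eq_prod, Measure.prod_restrict]

lemma cylinder_le_slab (Ω : Set (Space n)) (T : ℝ) : cylinder Ω T ≤ slab n T :=
  Measure.restrict_mono (prod_mono (subset_univ _) subset_rfl) le_rfl

lemma slab_restrict_cylinder (Ω : Set (Space n)) (hΩ : MeasurableSet Ω) (T : ℝ) :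
    (slab n T).restrict (Ω ×ˢ Ioc 0 T) = cylinder Ω T := by
  rw [slab, Measure.restrict_restrict (hΩ.prod measurableSet_Ioc), cylinder,
    inter_eq_left.2 (prod_mono (subset_univ _) subset_rfl)]

variable {Ω : Set (Space n)} {T : ℝ} {lam : Space n × ℝ → ℝ}

lemma memLp_source (hΩ : MeasurableSet Ω) (hlam : MemLp lam ⊤ (cylinder Ω T)) (f : L2Dom Ω) :
    MemLp ((Ω ×ˢ Ioc 0 T).indicator fun p => lam p * f p.1) 2 (slab n T) := by
  rw [memLp_indicator_iff_restrict (hΩ.prod measurableSet_Ioc), slab_restrict_cylinder Ω hΩ]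
  have h1 : MemLp (fun p : Space n × ℝ => f p.1) 2 (cylinder Ω T) := by
    rw [cylinder_eq_prod]
    exact (Lp.memLp f).comp_fst _
  exact h1.mul (r := 2) hlam

lemma ae_cylinder_of_ae_restrict {P : Space n → Prop}
    (h : ∀ᵐ x ∂(volume.restrict Ω), P x) : ∀ᵐ p ∂cylinder Ω T, P p.1 := by
  rw [cylinder_eq_prod]
  exact Measure.quasiMeasurePreserving_fst.ae h

lemma indicator_ae_eq_slab (hΩ : MeasurableSet Ω) {F G : Space n × ℝ → ℝ}
    (h : F =ᵐ[cylinder Ω T] G) :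
    (Ω ×ˢ Ioc 0 T).indicator F =ᵐ[slab n T] (Ω ×ˢ Ioc 0 T).indicator G := by
  rw [← slab_restrict_cylinder Ω hΩ] at h
  exact (ae_eq_restrict_iff_indicator_ae_eq (hΩ.prod measurableSet_Ioc)).1 h

lemma integral_indicator_slab (hΩ : MeasurableSet Ω) (F H : Space n × ℝ → ℝ) :
    ∫ p, (Ω ×ˢ Ioc 0 T).indicator F p * H p ∂slab n T = ∫ p, F p * H p ∂cylinder Ω T := by
  simp_rw [← indicator_mul_left]
  rw [integral_indicator (hΩ.prod measurableSet_Ioc), slab_restrict_cylinder Ω hΩ]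

/-- The source `λ f` of the direct problem, extended by zero, as a linear function of `f`. -/
def sourceLin (hΩ : MeasurableSet Ω) (hlam : MemLp lam ⊤ (cylinder Ω T)) :
    L2Dom Ω →ₗ[ℝ] L2Slab n T where
  toFun f := (memLp_source hΩ hlam f).toLp _
  map_add' f g := by
    rw [← MemLp.toLp_add, MemLp.toLp_eq_toLp_iff, ← indicator_add']
    refine indicator_ae_eq_slab hΩ ?_
    filter_upwards [ae_cylinder_of_ae_restrict (T := T) (Lp.coeFn_add f g)] with p hp
    rw [hp, Pi.add_apply, Pi.add_apply, mul_add]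
  map_smul' r f := by
    rw [RingHom.id_apply, ← MemLp.toLp_const_smul, MemLp.toLp_eq_toLp_iff]
    change _ =ᵐ[slab n T] fun p => r • (Ω ×ˢ Ioc 0 T).indicator (fun p => lam p * f p.1) p
    rw [← indicator_const_smul]
    refine indicator_ae_eq_slab hΩ ?_
    filter_upwards [ae_cylinder_of_ae_restrict (T := T) (Lp.coeFn_smul r f)] with p hp
    rw [hp]
    simp only [Pi.smul_apply, smul_eq_mul]
    ring

lemma norm_sourceLin_le (hΩ : MeasurableSet Ω) (hlam : MemLp lam ⊤ (cylinder Ω T))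
    (f : L2Dom Ω) : ‖sourceLin hΩ hlam f‖
      ≤ (eLpNorm lam ⊤ (cylinder Ω T) * (volume (Ioc 0 T)) ^ (1 / (2 : ℝ≥0∞)).toReal).toReal
        * ‖f‖ := by
  have h1 : ‖sourceLin hΩ hlam f‖ = _ := Lp.norm_toLp _ (memLp_source hΩ hlam f)
  have hf := Lp.memLp f
  -- Projecting the cylinder to `Ω` multiplies Lebesgue measure by the length of `(0,T]`, whose
  -- square root enters the bound.
  have hmap : Measure.map Prod.fst (cylinder Ω T)
      = volume (Ioc 0 T) • (volume : Measure (Space n)).restrict Ω := by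
    rw [cylinder_eq_prod, Measure.map_fst_prod, Measure.restrict_apply_univ]
  have h2 : eLpNorm (fun p : Space n × ℝ => f p.1) 2 (cylinder Ω T)
      = (volume (Ioc 0 T)) ^ (1 / (2 : ℝ≥0∞)).toReal * eLpNorm f 2 (volume.restrict Ω) := by
    have h3 := eLpNorm_map_measure (p := 2) (g := f) (f := Prod.fst) (μ := cylinder Ω T)
      (by rw [hmap]; exact hf.1.smul_measure _) measurable_fst.aemeasurable
    rw [hmap, eLpNorm_smul_measure_of_ne_top (by simp), smul_eq_mul] at h3
    exact h3.symm
  have hm : AEStronglyMeasurable (fun p : Space n × ℝ => f p.1) (cylinder Ω T) := by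
    rw [cylinder_eq_prod]
    exact hf.1.comp_fst
  have h4 := eLpNorm_smul_le_eLpNorm_top_mul_eLpNorm 2 hm lam
  rw [h1, eLpNorm_indicator_eq_eLpNorm_restrict (hΩ.prod measurableSet_Ioc),
    slab_restrict_cylinder Ω hΩ, Lp.norm_def, ← ENNReal.toReal_mul, mul_assoc, ← h2]
  refine ENNReal.toReal_mono ?_ h4
  refine ENNReal.mul_ne_top hlam.2.ne ?_
  rw [h2]
  refine ENNReal.mul_ne_top (ENNReal.rpow_ne_top_of_nonneg (by positivity) (by simp)) hf.2.ne

/-- The source operator `f ↦ λ f`. -/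
def sourceOp (hΩ : MeasurableSet Ω) (hlam : MemLp lam ⊤ (cylinder Ω T)) :
    L2Dom Ω →L[ℝ] L2Slab n T :=
  (sourceLin hΩ hlam).mkContinuous _ (norm_sourceLin_le hΩ hlam)

lemma integral_sourceOp_mul (hΩ : MeasurableSet Ω) (hlam : MemLp lam ⊤ (cylinder Ω T))
    (f : L2Dom Ω) (H : Space n × ℝ → ℝ) :
    ∫ p, sourceOp hΩ hlam f p * H p ∂slab n T = ∫ p, lam p * f p.1 * H p ∂cylinder Ω T := by
  rw [← integral_indicator_slab hΩ]
  refine integral_congr_ae ?_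
  filter_upwards [(memLp_source hΩ hlam f).coeFn_toLp] with p hp
  rw [← hp]
  rfl

lemma integrable_lam_mul (hΩb : Bornology.IsBounded Ω) (hlam : MemLp lam ⊤ (cylinder Ω T))
    (W : L2Slab n T) : Integrable (fun p => lam p * W p) (cylinder Ω T) := by
  have hfin : IsFiniteMeasure (cylinder Ω T) := by
    have : IsFiniteMeasure ((volume : Measure (Space n)).restrict Ω) :=
      ⟨by rw [Measure.restrict_apply_univ]; exact hΩb.measure_lt_top⟩
    rw [cylinder_eq_prod]
    infer_instance
  have hW : MemLp W 2 (cylinder Ω T) := (Lp.memLp W).mono_measure (cylinder_le_slab Ω T)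
  exact (hW.mul (r := 2) hlam).integrable one_le_two

/-- Fubini: a function on `Ω` is determined by its integrals over sets `s`, and pairing `M*W` with
the indicator of `s` gives the integral of `λW` over `s × (0,T]`. -/
lemma adjoint_sourceOp (hΩ : MeasurableSet Ω) (hΩb : Bornology.IsBounded Ω)
    (hlam : MemLp lam ⊤ (cylinder Ω T)) (W : L2Slab n T) :
    (∀ᵐ x ∂(volume.restrict Ω), IntegrableOn (fun t => lam (x, t) * W (x, t)) (Ioc 0 T)) ∧
      (ContinuousLinearMap.adjoint (sourceOp hΩ hlam) W : L2Dom Ω)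
        =ᵐ[volume.restrict Ω] fun x => ∫ t in Ioc 0 T, lam (x, t) * W (x, t) := by
  have : IsFiniteMeasure ((volume : Measure (Space n)).restrict Ω) :=
    ⟨by rw [Measure.restrict_apply_univ]; exact hΩb.measure_lt_top⟩
  have hi := integrable_lam_mul hΩb hlam W
  have hi' := hi
  rw [cylinder_eq_prod] at hi'
  refine ⟨hi'.prod_right_ae, ?_⟩
  refine Integrable.ae_eq_of_forall_setIntegral_eq _ _ ((Lp.memLp _).integrable one_le_two)
    hi'.integral_prod_left fun s hs hμs => ?_
  have h1 := L2.inner_indicatorConstLp_one (𝕜 := ℝ) hs hμs.ne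
    (ContinuousLinearMap.adjoint (sourceOp hΩ hlam) W)
  rw [← h1, ContinuousLinearMap.adjoint_inner_right, L2.inner_def]
  have h2 : ∫ p, inner ℝ (sourceOp hΩ hlam (indicatorConstLp 2 hs hμs.ne 1) p) (W p) ∂slab n T
      = ∫ p, sourceOp hΩ hlam (indicatorConstLp 2 hs hμs.ne 1) p * W p ∂slab n T :=
    integral_congr_ae (Eventually.of_forall fun p => mul_comm _ _)
  rw [h2, integral_sourceOp_mul]
  have h3 : ∫ p, lam p * (indicatorConstLp 2 hs hμs.ne (1 : ℝ) : L2Dom Ω) p.1 * W p ∂cylinder Ω T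
      = ∫ p, (s ×ˢ univ).indicator (fun p => lam p * W p) p ∂cylinder Ω T := by
    refine integral_congr_ae ?_
    filter_upwards [ae_cylinder_of_ae_restrict (T := T)
      (indicatorConstLp_coeFn (p := 2) (hs := hs) (hμs := hμs.ne) (c := (1 : ℝ)))] with p hp
    rw [hp]
    by_cases hps : p.1 ∈ s
    · simp [hps]
    · simp [hps]
  rw [h3, integral_indicator (hs.prod MeasurableSet.univ), cylinder_eq_prod,
    setIntegral_prod _ (hi'.integrableOn), Measure.restrict_univ]

end Source

/-! ### Solvability of the two problems and the forward operator -/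

section Problems

variable {n : ℕ} {c T : ℝ} {Ω Γ : Set (Space n)} {lam : Space n × ℝ → ℝ}

lemma isDirectSolution_unique (hc : 0 < c) {f : L2Dom Ω} {U U' : L2Slab n T}
    (h : IsDirectSolution c T Ω lam f U) (h' : IsDirectSolution c T Ω lam f U') : U = U' := by
  rw [← sub_eq_zero, Lp.eq_zero_iff_ae_eq_zero]
  refine slab_forward_unique hc (Lp.memLp _) fun φ hφ hs => ?_
  have h1 := (h.2 φ hφ hs).trans (h'.2 φ hφ hs).symm
  rw [← inner_waveToLp c T ⟨φ, hφ⟩, ← inner_waveToLp c T ⟨φ, hφ⟩] at h1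
  rw [← inner_waveToLp c T ⟨φ, hφ⟩, inner_sub_right, h1, sub_self]

lemma isAdjointSolution_unique (hc : 0 < c) {V : L2Lat Γ T} {W W' : L2Slab n T}
    (h : IsAdjointSolution c T Γ V W) (h' : IsAdjointSolution c T Γ V W') : W = W' := by
  rw [← sub_eq_zero, Lp.eq_zero_iff_ae_eq_zero]
  refine slab_backward_unique hc (Lp.memLp _) fun φ hφ hs => ?_
  have h1 := (h φ hφ hs).trans (h' φ hφ hs).symm
  rw [← inner_waveToLp c T ⟨φ, hφ⟩, ← inner_waveToLp c T ⟨φ, hφ⟩] at h1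
  rw [← inner_waveToLp c T ⟨φ, hφ⟩, inner_sub_right, h1, sub_self]

lemma isDirectSolution_solutionOp (hc : 0 < c) [IsFiniteMeasureOnCompacts (lateral Γ T)]
    (hS : ∀ φ : posTestSpace n, solutionOp c T Γ (posWave c T φ) = sobolevData Γ T φ.1)
    (hΩ : MeasurableSet Ω) (hlam : MemLp lam ⊤ (cylinder Ω T)) (f : L2Dom Ω) :
    IsDirectSolution c T Ω lam f (solutionOp c T Γ (sourceOp hΩ hlam f)).1 := by
  refine ⟨⟨_, (isSobolevLimit_solutionOp hc hS _).isWeakGradX⟩, fun φ hφ hs => ?_⟩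
  rw [← inner_waveToLp c T ⟨φ, hφ⟩, inner_waveToLp_solutionOp hc hS hs, inner_testToLp,
    integral_sourceOp_mul]

/-- The trace of the solution of the direct problem, as an operator on the sources. -/
def traceOp (c T : ℝ) (Γ : Set (Space n)) [IsFiniteMeasureOnCompacts (lateral Γ T)] :
    L2Slab n T →L[ℝ] L2Lat Γ T :=
  (ContinuousLinearMap.snd ℝ _ _).comp ((ContinuousLinearMap.snd ℝ _ _).comp (solutionOp c T Γ))

/-- Transposition: every admissible `φ` is the direct solution for the source `□φ`, so pairing `□φ`
with the adjoint gives the pairing of the trace of `φ` with `V`. -/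
lemma isAdjointSolution_adjoint_traceOp [IsFiniteMeasureOnCompacts (lateral Γ T)]
    (hS : ∀ φ : posTestSpace n, solutionOp c T Γ (posWave c T φ) = sobolevData Γ T φ.1)
    (V : L2Lat Γ T) :
    IsAdjointSolution c T Γ V (ContinuousLinearMap.adjoint (traceOp c T Γ) V) := by
  intro φ hφ hs
  rw [← inner_waveToLp c T ⟨φ, hφ⟩, ContinuousLinearMap.adjoint_inner_right,
    ← inner_testToLp (lateral Γ T) ⟨φ, hφ⟩]
  congr 1
  exact congrArg (fun S => S.2.2) (hS ⟨⟨φ, hφ⟩, hs⟩)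

lemma isForwardOperator_traceOp_comp (hc : 0 < c) [IsFiniteMeasureOnCompacts (lateral Γ T)]
    (hS : ∀ φ : posTestSpace n, solutionOp c T Γ (posWave c T φ) = sobolevData Γ T φ.1)
    (hΩo : IsOpen Ω) (hΩb : Bornology.IsBounded Ω) (hΩl : HasLipschitzBoundary Ω)
    (hΓ : Γ ⊆ frontier Ω) (hlam : MemLp lam ⊤ (cylinder Ω T)) :
    IsForwardOperator c T Ω Γ lam
      ((traceOp c T Γ).comp (sourceOp hΩo.measurableSet hlam)) := by
  intro f v
  have hdir := isDirectSolution_solutionOp hc hS hΩo.measurableSet hlam f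
  have htr : IsTrace (solutionOp c T Γ (sourceOp hΩo.measurableSet hlam f)).1
      (((traceOp c T Γ).comp (sourceOp hΩo.measurableSet hlam)) f) :=
    isTrace_iff.2 ⟨_, isSobolevLimit_solutionOp hc hS _⟩
  constructor
  · rintro rfl
    exact ⟨_, hdir, htr⟩
  · rintro ⟨U, hU, hUv⟩
    rw [isDirectSolution_unique hc hU hdir] at hUv
    exact isTrace_unique hΩo hΩb hΩl hΓ htr hUv

lemma hasGradientAt_leastSquares (F : L2Dom Ω →L[ℝ] L2Lat Γ T) (Udata : L2Lat Γ T) (f : L2Dom Ω) :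
    HasGradientAt (leastSquares F Udata) (ContinuousLinearMap.adjoint F (F f - Udata)) f := by
  rw [hasGradientAt_iff_hasFDerivAt]
  have h : HasFDerivAt (leastSquares F Udata) _ f :=
    ((F.hasFDerivAt (x := f)).sub_const Udata).norm_sq.const_mul (1 / 2)
  refine h.congr_fderiv (ContinuousLinearMap.ext fun g => ?_)
  simp [ContinuousLinearMap.adjoint_inner_left]

end Problems

end InverseSource

end

/-! ### The main theorem -/

theorem mainTheorem3
    (n : ℕ) (hn : n = 2 ∨ n = 3) (c T : ℝ) (hc : 0 < c) (hT : 0 < T)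
    (Ω : Set (InverseSource.Space n)) (hΩo : IsOpen Ω) (hΩb : Bornology.IsBounded Ω)
    (hΩl : InverseSource.HasLipschitzBoundary Ω)
    (Γ : Set (InverseSource.Space n)) (hΓm : MeasurableSet Γ) (hΓ : Γ ⊆ frontier Ω)
    (lam : InverseSource.Space n × ℝ → ℝ) (hlam : MemLp lam ∞ (InverseSource.cylinder Ω T)) :
    -- the direct and the time-reversed problem are uniquely solvable
    (∀ f : InverseSource.L2Dom Ω, ∃! U, InverseSource.IsDirectSolution c T Ω lam f U) ∧
    (∀ V : InverseSource.L2Lat Γ T, ∃! W, InverseSource.IsAdjointSolution c T Γ V W) ∧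
    -- the forward operator is a bounded linear operator
    ∃ F : InverseSource.L2Dom Ω →L[ℝ] InverseSource.L2Lat Γ T,
      InverseSource.IsForwardOperator c T Ω Γ lam F ∧
      -- the Fréchet derivative of the least-squares functional
      (∀ (Udata : InverseSource.L2Lat Γ T) (f : InverseSource.L2Dom Ω),
        HasGradientAt (InverseSource.leastSquares F Udata)
          (ContinuousLinearMap.adjoint F (F f - Udata)) f) ∧
      -- the adjoint operator
      ∀ (V : InverseSource.L2Lat Γ T) (W : InverseSource.L2Slab n T),
        InverseSource.IsAdjointSolution c T Γ V W →
          (∀ᵐ x ∂(volume.restrict Ω),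
            IntegrableOn (fun t => lam (x, t) * W (x, t)) (Ioc 0 T)) ∧
          (ContinuousLinearMap.adjoint F V : InverseSource.L2Dom Ω)
            =ᵐ[volume.restrict Ω] fun x => ∫ t in Ioc 0 T, lam (x, t) * W (x, t) := by
  have hfin := InverseSource.isFiniteMeasure_lateral hΩo hΩb hΩl hΓ T
  have hS : ∀ φ : InverseSource.posTestSpace n,
      InverseSource.solutionOp c T Γ (InverseSource.posWave c T φ)
        = InverseSource.sobolevData Γ T φ.1 :=
    InverseSource.solutionOp_posWave hc hT hΩo hΩb hΩl hΓ
  refine ⟨fun f => ⟨_, InverseSource.isDirectSolution_solutionOp hc hS hΩo.measurableSet hlam f,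
      fun U hU => InverseSource.isDirectSolution_unique hc hU
        (InverseSource.isDirectSolution_solutionOp hc hS hΩo.measurableSet hlam f)⟩,
    fun V => ⟨_, InverseSource.isAdjointSolution_adjoint_traceOp hS V,
      fun W hW => InverseSource.isAdjointSolution_unique hc hW
        (InverseSource.isAdjointSolution_adjoint_traceOp hS V)⟩,
    (InverseSource.traceOp c T Γ).comp (InverseSource.sourceOp hΩo.measurableSet hlam),
    InverseSource.isForwardOperator_traceOp_comp hc hS hΩo hΩb hΩl hΓ hlam,
    InverseSource.hasGradientAt_leastSquares _, fun V W hW => ?_⟩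
  -- By uniqueness the given `W` is `R*V`, and `F* = M* R*` reduces the claim to the formula for
  -- `M*`.
  rw [InverseSource.isAdjointSolution_unique hc hW
    (InverseSource.isAdjointSolution_adjoint_traceOp hS V), ContinuousLinearMap.adjoint_comp]
  exact InverseSource.adjoint_sourceOp hΩo.measurableSet hΩb hlam _
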